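/- \textbf{Theorem.} There is a simple orthogonal polygon that folds orthogonally, with creases parallel to its sides, to a nonorthogonal polyhedron of genus 7. Explicitly, let $L=3$, $b=L/\sqrt2$, and let $e_1,e_2,e_3$ be the standard basis of $\mathbb R^3$. Consider the 54 points \[ a_{k,u}=b\,u\,e_k,\qquad p_{k,s}=b\,s_k e_k+\tfrac12 s,\qquad q_{k,s}=p_{k,s}+s_k e_k \qquad (k\in\{1,2,3\},\ u=\pm1,\ s\in\{\pm1\}^3), \] and the following 66 rectangles, each given by its vertices: \begin{itemize} \item for each of the 12 pairs consisting of two axes $i<j$ and signs $\alpha,\beta$ of these axes (with $m$ the third axis): the $L\times1$ rectangle with vertices $p_{i,s},p_{j,s}$, where $s_i=\alpha$, $s_j=\beta$, $s_m=\pm1$; and, for each value of $s_m=\pm1$, the $L\times\frac{\sqrt3}{2}$ rectangle with vertices $a_{i,\alpha},a_{j,\beta},p_{j,s},p_{i,s}$ (these three are the long faces of a triangular prism joining two vertices of an octahedron); \item for each axis $k$ and sign $u$: the five faces, other than the square with vertices $p_{k,s}$, of the unit cube with vertices $p_{k,s},q_{k,s}$ ($s_k=u$). \end{itemize} Then these 66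 rectangles are the faces of a polyhedron $P$, which is connected with $V-E+F=54-132+66=-12=2-2\cdot 7$ (so it has genus 7) and is not orthogonal, and there is a simple orthogonal polygon that folds orthogonally to $P$. Here a \emph{polyhedron} is a surface formed of finitely many planar faces, each a simple polygon, such that any two are disjoint, share one vertex, or share an edge, each edge is shared by exactly two faces, and the link of each vertex is a cycle. It is \emph{orthogonal} if all its dihedral angles are multiples of $\pi/2$. A \emph{simple orthogonal polygon} is a simple planar polygon, with the region $N$ it encloses, whose consecutive sides meet at right angles. It \emph{folds orthogonally} to $P$ if there are finitely many crease segments in $N$, parallel to sides of the polygon, and a continuous map from $N$ onto the surface $P$ that is a rigid motion near every interior point of $N$ off the creases and identifies no two distinct points of $N$ unless both lie on the perimeter. -/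

import Mathlib

open Topology

namespace NonorthFold

/-- The Euclidean plane. -/
abbrev E2 : Type := EuclideanSpace ℝ (Fin 2)

/-- Euclidean 3-space. -/
abbrev E3 : Type := EuclideanSpace ℝ (Fin 3)

/-! ### Polygons

The sides of a closed polygon `p : Polygon P n` are the segments `p.edgeSet ℝ i` from `p i` to the
cyclically next vertex `p (finRotate n i)`. -/

/-- A simple polygon: at least three vertices, all distinct; consecutive sides meet only in their
common vertex, and any other two sides are disjoint. -/
structure IsSimple {P : Type*} [AddCommGroup P] [Module ℝ P] {n : ℕ} (p : Polygon P n) :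
    Prop where
  three_le : 3 ≤ n
  injective : Function.Injective p.vertices
  consecutive : ∀ i, p.edgeSet ℝ i ∩ p.edgeSet ℝ (finRotate n i) = {p (finRotate n i)}
  disjoint : ∀ i j, i ≠ j → j ≠ finRotate n i → i ≠ finRotate n j →
    Disjoint (p.edgeSet ℝ i) (p.edgeSet ℝ j)

/-- `R` is the closed region enclosed by the polygon `p`. By the Jordan curve theorem, for a simple
polygon there is exactly one compact set with non-empty interior whose frontier is the boundary
curve: the union of the curve and the bounded component of its complement. -/
structure IsRegionOf {n : ℕ} (R : Set E2) (p : Polygon E2 n) : Prop where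
  compact : IsCompact R
  interior_nonempty : (interior R).Nonempty
  frontier_eq : frontier R = p.boundary ℝ

/-- Consecutive sides of the polygon are perpendicular. -/
def HasRightAngles {n : ℕ} (p : Polygon E2 n) : Prop :=
  ∀ i, inner ℝ (p (finRotate n i) - p i)
    (p (finRotate n (finRotate n i)) - p (finRotate n i)) = 0

/-- A simple orthogonal polygon `p` together with the region `N` that it encloses. -/
structure IsOrthogonalNet {n : ℕ} (p : Polygon E2 n) (N : Set E2) : Prop where
  simple : IsSimple p
  rightAngles : HasRightAngles p
  region : IsRegionOf N p

/-- The polygon `q` in 3-space is a simple planar polygon and `S` is the closed planar region that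
it encloses: both are carried from the plane into space by one isometry. -/
def IsPlanarPolygon {n : ℕ} (q : Polygon E3 n) (S : Set E3) : Prop :=
  ∃ (φ : E2 →ᵃⁱ[ℝ] E3) (p : Polygon E2 n) (R : Set E2),
    IsSimple p ∧ IsRegionOf R p ∧ (∀ i, q i = φ (p i)) ∧ S = φ '' R

/-! ### Polyhedra -/

/-- The data of a polygonal surface in 3-space: vertices with their positions, and faces, each with
a cyclic sequence of vertices (its corners) and the set of points that it covers. -/
structure PolygonalSurface where
  V : Type
  F : Type
  pos : V → E3
  size : F → ℕ
  corner : (f : F) → Fin (size f) → V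
  region : F → Set E3

namespace PolygonalSurface

variable (P : PolygonalSurface)

/-- The points of the surface. -/
def carrier : Set E3 := ⋃ f, P.region f

/-- The edges of the face `f`, as pairs of vertices. -/
def faceEdges (f : P.F) : Set (Sym2 P.V) :=
  Set.range fun i => s(P.corner f i, P.corner f (finRotate _ i))

/-- The edges of the surface. -/
def edges : Set (Sym2 P.V) := ⋃ f, P.faceEdges f

/-- The link of the vertex `v`: its nodes are the edges at `v`, and two of them are joined when they
are edges of a common face. -/
def link (v : P.V) : SimpleGraph {e : Sym2 P.V // e ∈ P.edges ∧ v ∈ e} where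
  Adj e e' := e ≠ e' ∧ ∃ f, e.1 ∈ P.faceEdges f ∧ e'.1 ∈ P.faceEdges f
  symm := ⟨fun _ _ h => ⟨h.1.symm, h.2.imp fun _ hf => ⟨hf.2, hf.1⟩⟩⟩
  loopless := ⟨fun _ h => h.1 rfl⟩

/-- A polyhedron: finitely many planar faces, each a simple polygon, any two of which are disjoint,
share one vertex or share an edge; each edge belongs to exactly two faces; and the link of each
vertex is a cycle. -/
structure IsPolyhedron : Prop where
  finite_V : Finite P.V
  finite_F : Finite P.F
  pos_injective : Function.Injective P.pos
  vertex_mem : ∀ v, ∃ f i, P.corner f i = v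
  face : ∀ f, IsPlanarPolygon ⟨fun i => P.pos (P.corner f i)⟩ (P.region f)
  inter : ∀ f g, f ≠ g →
    Disjoint (P.region f) (P.region g) ∨
    (∃ i j, P.corner f i = P.corner g j ∧
      P.region f ∩ P.region g = {P.pos (P.corner f i)}) ∨
    (∃ v w, s(v, w) ∈ P.faceEdges f ∧ s(v, w) ∈ P.faceEdges g ∧
      P.region f ∩ P.region g = segment ℝ (P.pos v) (P.pos w))
  two_faces : ∀ e ∈ P.edges, {f | e ∈ P.faceEdges f}.ncard = 2
  link_cycle : ∀ v, ∃ k, 3 ≤ k ∧ Nonempty (P.link v ≃g SimpleGraph.cycleGraph k)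

/-- The surface is connected and satisfies Euler's formula `V - E + F = 2 - 2g`. (A polyhedron in
3-space is a closed orientable surface, so this says that its genus is `g`.) -/
def HasGenus (g : ℕ) : Prop :=
  IsConnected P.carrier ∧
    (Nat.card P.V : ℤ) - (P.edges.ncard : ℤ) + (Nat.card P.F : ℤ) = 2 - 2 * (g : ℤ)

end PolygonalSurface

/-- `u` is the unit vector that is perpendicular to the side from `a` to `b` of a planar region `S`
and points from this side into `S`. -/
structure IsInwardNormal (S : Set E3) (a b u : E3) : Prop where
  unit : ‖u‖ = 1
  perp : inner ℝ u (b - a) = 0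
  inward : ∀ᶠ t : ℝ in 𝓝[>] 0, midpoint ℝ a b + t • u ∈ S

/-- All dihedral angles are multiples of `π / 2`. The dihedral angle at an edge is `θ` or `2π - θ`,
where `θ` is the angle between the inward normals of the edge in its two faces; so it is a multiple
of `π / 2` exactly when `θ` is. -/
def PolygonalSurface.IsOrthogonal (P : PolygonalSurface) : Prop :=
  ∀ f g : P.F, f ≠ g → ∀ v w : P.V, s(v, w) ∈ P.faceEdges f → s(v, w) ∈ P.faceEdges g →
    ∀ u u' : E3, IsInwardNormal (P.region f) (P.pos v) (P.pos w) u →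
      IsInwardNormal (P.region g) (P.pos v) (P.pos w) u' →
      ∃ k : ℤ, InnerProductGeometry.angle u u' = k * (Real.pi / 2)

/-! ### Orthogonal foldings -/

/-- `f` is an orthogonal folding of the net `N`, with boundary polygon `p`, to the surface `S`, with
the set `C` of crease segments (given by their endpoints). The creases are finitely many segments in
`N` parallel to sides of `p`. The map `f` is continuous; near every interior point off the creases
it is a rigid motion of the plane into space (hence it is one rigid motion on each panel into which
the creases cut the interior of `N`); it covers `S`; and only points of the perimeter are glued,
namely to other points of the perimeter. -/
structure IsOrthogonalFolding {n : ℕ} (p : Polygon E2 n) (N : Set E2) (S : Set E3)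
    (C : Set (E2 × E2)) (f : E2 → E3) : Prop where
  finite_creases : C.Finite
  crease_ne : ∀ c ∈ C, c.1 ≠ c.2
  crease_subset : ∀ c ∈ C, segment ℝ c.1 c.2 ⊆ N
  crease_parallel : ∀ c ∈ C, ∃ (i : Fin n) (t : ℝ), c.2 - c.1 = t • (p (finRotate n i) - p i)
  continuousOn : ContinuousOn f N
  rigid : ∀ x ∈ interior N, (∀ c ∈ C, x ∉ segment ℝ c.1 c.2) →
    ∃ φ : E2 →ᵃⁱ[ℝ] E3, ∀ᶠ y in 𝓝 x, f y = φ y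
  image_eq : f '' N = S
  glue : ∀ x ∈ N, ∀ y ∈ N, f x = f y → x = y ∨ (x ∈ frontier N ∧ y ∈ frontier N)

/-- The region `N` of the polygon `p` folds orthogonally to the surface `S`. -/
def FoldsOrthogonally {n : ℕ} (p : Polygon E2 n) (N : Set E2) (S : Set E3) : Prop :=
  ∃ (C : Set (E2 × E2)) (f : E2 → E3), IsOrthogonalFolding p N S C f

/-! ### The polyhedron

At the end of each half-axis of a regular octahedron (axis `k`, sign `s k`) sits a cluster: the
four corners `base k s` of a unit square perpendicular to the axis, indexed by the signs `s` of
their coordinates; the point `apex k (s k)` on the axis, `1/2` nearer to the origin than the square;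
and the four outer corners `top k s` of the unit cube erected outward on the square. The square
itself is not a face; it is replaced by the five other faces of the cube. For each of the twelve
edges of the octahedron, a triangular prism of length `L` without its two triangular ends joins the
two clusters; each end has the vertices of one side of the square and the apex. -/

/-- The 54 vertices. -/
inductive Vertex : Type
  | apex (k : Fin 3) (u : ℤˣ)
  | base (k : Fin 3) (s : Fin 3 → ℤˣ)
  | top (k : Fin 3) (s : Fin 3 → ℤˣ)

/-- The sign vector with the entries `t`, `a`, `c` in the positions `k`, `k + 1`, `k + 2`
(modulo 3). -/
def signs (k : Fin 3) (t a c : ℤˣ) : Fin 3 → ℤˣ :=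
  fun m => if m = k then t else if m = k + 1 then a else c

/-- The 66 faces: for the prism that joins the half-axes `(k + 1, a)` and `(k + 2, c)`, its outer
face of size `L × 1` and its two inner faces of size `L × √3/2`; the two cube sides that meet the
ends of this outer face; and the outermost face of each of the six cubes. -/
inductive Face : Type
  | outer (k : Fin 3) (a c : ℤˣ)
  | inner (k : Fin 3) (t a c : ℤˣ)
  | side₁ (k : Fin 3) (a c : ℤˣ)
  | side₂ (k : Fin 3) (a c : ℤˣ)
  | lid (k : Fin 3) (t : ℤˣ)

open Vertex in
/-- The four corners of each face, in cyclic order. -/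
def faceCorner : Face → Fin 4 → Vertex
  | .outer k a c => ![base (k + 1) (signs k 1 a c), base (k + 1) (signs k (-1) a c),
      base (k + 2) (signs k (-1) a c), base (k + 2) (signs k 1 a c)]
  | .inner k t a c => ![apex (k + 1) a, apex (k + 2) c,
      base (k + 2) (signs k t a c), base (k + 1) (signs k t a c)]
  | .side₁ k a c => ![base (k + 1) (signs k 1 a c), base (k + 1) (signs k (-1) a c),
      top (k + 1) (signs k (-1) a c), top (k + 1) (signs k 1 a c)]
  | .side₂ k a c => ![base (k + 2) (signs k 1 a c), base (k + 2) (signs k (-1) a c),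
      top (k + 2) (signs k (-1) a c), top (k + 2) (signs k 1 a c)]
  | .lid k t => ![top k (signs k t 1 1), top k (signs k t 1 (-1)),
      top k (signs k t (-1) (-1)), top k (signs k t (-1) 1)]

/-- The vertex positions for prisms of length `L`; the apexes have distance `L / √2` from the
origin. -/
noncomputable def vertexPos (L : ℝ) : Vertex → E3
  | .apex k u => WithLp.toLp 2 fun m =>
      if m = k then L / √2 * ((u : ℤ) : ℝ) else 0
  | .base k s => WithLp.toLp 2 fun m =>
      (if m = k then L / √2 * ((s m : ℤ) : ℝ) else 0) + ((s m : ℤ) : ℝ) / 2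
  | .top k s => WithLp.toLp 2 fun m =>
      (if m = k then (L / √2 + 1) * ((s m : ℤ) : ℝ) else 0) + ((s m : ℤ) : ℝ) / 2

/-- The octahedral arrangement of twelve triangular prisms of length `L` and six unit cubes; each
face is the rectangle spanned by its four corners. -/
noncomputable def cubedOctopus (L : ℝ) : PolygonalSurface where
  V := Vertex
  F := Face
  pos := vertexPos L
  size := fun _ => 4
  corner := faceCorner
  region := fun f => convexHull ℝ (Set.range fun i => vertexPos L (faceCorner f i))

end NonorthFold

/-! The surface bounds a thickened octahedron graph. A triangular prism runs along each of the
twelve edges; at each of the six vertices sits a cube on the base of a square pyramid of height 1/2,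
whose slanted sides are the ends of the four prisms that arrive there. These ends and the pyramid
bases lie inside the solid and are omitted, so only rectangles remain as faces. The graph has 12 - 6
+ 1 = 7 independent cycles, which is the genus; the formal count is that of V - E + F. A prism has
an isosceles cross-section with sides 1, √3/2, √3/2, whose apex angle has cosine 1/3, so the surface
is not orthogonal.

Since all faces are rectangles, any edge unfolding whose panels are placed parallel to the axes has
orthogonal creases. The net is given explicitly on a grid with gaps 1, 3 and √3/2, and everything is
reduced to finite integer checks evaluated by the kernel. Three reductions carry the proof.

Plane topology: membership in a union of grid boxes is constant on the cells of the grid, and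
interior points are recognised from the neighbouring cells. So the frontier of the region is
computed cell by cell (`IsGridNet.frontier_eq`), and no form of the Jordan curve theorem is needed.

Geometry in space: the coordinates are affine in B = 3/√2, which lies between 2 and 3, so
inequalities that hold for both integers hold for B. For each pair of faces an integral functional
separates them except at common corners (`all_separates`); hence they meet exactly in the hull of
their common corners (`faceRegion_inter`).

Folding: each panel is carried to its face by an isometry. Panels that meet in the net do so in a
corner or side that their faces share too, so the isometries agree there (`panelMap_eq`) and paste
to a continuous map. Points glued by it lie at corners or on cut edges, and all of these are on the
perimeter (`netMap_glue`). -/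

namespace NonorthFold

/-! ### Planar regions on a grid

The lines `x = xs i` and `y = ys j` of a grid cut each axis into cells: the cell `2 * i` is the
point `xs i`, and the cell `2 * i + 1` is the open interval from `xs i` to `xs (i + 1)`. -/

/-- The point of the plane with the coordinates `x`, `y`. -/
noncomputable def pt (x y : ℝ) : E2 := !₂[x, y]

@[simp] lemma pt_zero (x y : ℝ) : pt x y 0 = x := rfl
@[simp] lemma pt_one (x y : ℝ) : pt x y 1 = y := rfl

lemma E2_ext {p q : E2} (h0 : p 0 = q 0) (h1 : p 1 = q 1) : p = q := by
  ext i; fin_cases i <;> assumption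

lemma pt_eta (p : E2) : pt (p 0) (p 1) = p := E2_ext rfl rfl

/-- `t` lies in the cell `d` of the grid `xs`. -/
def Cell (xs : ℕ → ℝ) (d : ℕ) (t : ℝ) : Prop :=
  if d % 2 = 0 then t = xs (d / 2) else xs (d / 2) < t ∧ t < xs (d / 2 + 1)

lemma cell_even {xs : ℕ → ℝ} {i : ℕ} {t : ℝ} : Cell xs (2 * i) t ↔ t = xs i := by
  simp [Cell]

lemma cell_odd {xs : ℕ → ℝ} {i : ℕ} {t : ℝ} :
    Cell xs (2 * i + 1) t ↔ xs i < t ∧ t < xs (i + 1) := by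
  have h : (2 * i + 1) / 2 = i := by omega
  simp [Cell, h, Nat.add_mod]

section cells

variable {xs : ℕ → ℝ} (hx : StrictMono xs)

include hx

/-- The grid line `a` is itself the cell `2 * a`, so comparing a point with a grid line amounts to
comparing cell numbers. This is why membership in a box depends only on the cell of a point. -/
lemma cell_ge_iff {d : ℕ} {t : ℝ} (h : Cell xs d t) (a : ℕ) : xs a ≤ t ↔ 2 * a ≤ d := by
  obtain ⟨i, rfl | rfl⟩ := Nat.even_or_odd' d
  · rw [cell_even] at h
    rw [h, hx.le_iff_le]; omega
  · rw [cell_odd] at h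
    constructor
    · intro h'
      have := hx.lt_iff_lt.1 (h'.trans_lt h.2); omega
    · intro h'
      exact (hx.monotone (by omega : a ≤ i)).trans h.1.le

lemma cell_le_iff {d : ℕ} {t : ℝ} (h : Cell xs d t) (b : ℕ) : t ≤ xs b ↔ d ≤ 2 * b := by
  obtain ⟨i, rfl | rfl⟩ := Nat.even_or_odd' d
  · rw [cell_even] at h
    rw [h, hx.le_iff_le]; omega
  · rw [cell_odd] at h
    constructor
    · intro h'
      have := hx.lt_iff_lt.1 (h.1.trans_le h'); omega
    · intro h'
      exact h.2.le.trans (hx.monotone (by omega : i + 1 ≤ b))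

omit hx in
lemma exists_cell {t : ℝ} (h0 : xs 0 ≤ t) {m : ℕ} (hm : t ≤ xs m) : ∃ d ≤ 2 * m, Cell xs d t := by
  induction m with
  | zero => exact ⟨0, le_rfl, by rw [← Nat.mul_zero 2, cell_even]; exact le_antisymm hm h0⟩
  | succ m ih =>
    rcases le_or_gt t (xs m) with h | h
    · obtain ⟨d, hd, hc⟩ := ih h
      exact ⟨d, by omega, hc⟩
    · rcases hm.lt_or_eq with h' | h'
      · exact ⟨2 * m + 1, by omega, cell_odd.2 ⟨h, h'⟩⟩
      · exact ⟨2 * (m + 1), le_rfl, cell_even.2 h'⟩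

/-- The cells whose closures meet the cell `d` or that lie in its closure. -/
def nearCells (d : ℕ) : List ℕ := if d % 2 = 0 then [d - 1, d, d + 1] else [d]

omit hx in
lemma mem_nearCells {d e : ℕ} :
    e ∈ nearCells d ↔ e = d ∨ (d % 2 = 0 ∧ (e = d - 1 ∨ e = d + 1)) := by
  unfold nearCells; split_ifs with h <;> simp [h]; tauto

/-- With `mem_closure_cell` this characterises the cells that matter near `t`: they cover a
neighbourhood of `t`, and each of them accumulates at `t`. For `d = 0` there is no cell to the left,
whence `0 < d`. -/
lemma eventually_near {d : ℕ} (hd : 0 < d) {t : ℝ} (h : Cell xs d t) :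
    ∀ᶠ u in 𝓝 t, ∃ e ∈ nearCells d, Cell xs e u := by
  obtain ⟨i, rfl | rfl⟩ := Nat.even_or_odd' d
  · obtain ⟨i, rfl⟩ := Nat.exists_eq_succ_of_ne_zero (by omega : i ≠ 0)
    rw [cell_even] at h
    have hm : Set.Ioo (xs i) (xs (i + 2)) ∈ 𝓝 t :=
      Ioo_mem_nhds (h ▸ hx (Nat.lt_succ_self i)) (h ▸ hx (Nat.lt_succ_self (i + 1)))
    filter_upwards [hm] with u hu
    rcases lt_trichotomy u (xs (i + 1)) with h' | h' | h'
    · exact ⟨2 * i + 1, mem_nearCells.2 (by omega), cell_odd.2 ⟨hu.1, h'⟩⟩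
    · exact ⟨2 * (i + 1), mem_nearCells.2 (by omega), cell_even.2 h'⟩
    · exact ⟨2 * (i + 1) + 1, mem_nearCells.2 (by omega), cell_odd.2 ⟨h', hu.2⟩⟩
  · have h' := cell_odd.1 h
    filter_upwards [Ioo_mem_nhds h'.1 h'.2] with u hu
    exact ⟨2 * i + 1, mem_nearCells.2 (by omega), cell_odd.2 hu⟩

lemma mem_closure_cell {d e : ℕ} (hd : 0 < d) {t : ℝ} (h : Cell xs d t) (he : e ∈ nearCells d) :
    t ∈ closure {u | Cell xs e u} := by
  rcases mem_nearCells.1 he with rfl | ⟨h2, h'⟩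
  · exact subset_closure h
  obtain ⟨i, rfl⟩ : ∃ i, d = 2 * (i + 1) := ⟨d / 2 - 1, by omega⟩
  rw [cell_even] at h
  rcases h' with rfl | rfl
  · rw [show 2 * (i + 1) - 1 = 2 * i + 1 by omega]
    simp only [cell_odd]
    change t ∈ closure (Set.Ioo _ _)
    rw [closure_Ioo (hx (Nat.lt_succ_self i)).ne]
    exact ⟨h ▸ (hx (Nat.lt_succ_self i)).le, h.le⟩
  · simp only [cell_odd]
    change t ∈ closure (Set.Ioo _ _)
    rw [closure_Ioo (hx (Nat.lt_succ_self (i + 1))).ne]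
    exact ⟨h.ge, h ▸ (hx (Nat.lt_succ_self (i + 1))).le⟩

end cells

/-- A box on the grid, given by the indices of its grid lines. -/
structure Box where
  x₀ : ℕ
  x₁ : ℕ
  y₀ : ℕ
  y₁ : ℕ
deriving DecidableEq

/-- The closed rectangle of a box. -/
def Box.toSet (xs ys : ℕ → ℝ) (B : Box) : Set E2 :=
  {p | (xs B.x₀ ≤ p 0 ∧ p 0 ≤ xs B.x₁) ∧ ys B.y₀ ≤ p 1 ∧ p 1 ≤ ys B.y₁}

/-- The cell `(d, e)` lies in the box. -/
def Box.HasCell (B : Box) (d e : ℕ) : Prop :=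
  (2 * B.x₀ ≤ d ∧ d ≤ 2 * B.x₁) ∧ 2 * B.y₀ ≤ e ∧ e ≤ 2 * B.y₁

instance (B : Box) (d e : ℕ) : Decidable (B.HasCell d e) := by
  unfold Box.HasCell; infer_instance

/-- The box in which two boxes meet. -/
def Box.inter (A B : Box) : Box :=
  ⟨max A.x₀ B.x₀, min A.x₁ B.x₁, max A.y₀ B.y₀, min A.y₁ B.y₁⟩

/-- The box has no points. -/
def Box.IsVoid (B : Box) : Prop := B.x₁ < B.x₀ ∨ B.y₁ < B.y₀

instance (B : Box) : Decidable B.IsVoid := by unfold Box.IsVoid; infer_instance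

/-- The smallest box with two given grid points. -/
def spanBox (a b : ℕ × ℕ) : Box := ⟨min a.1 b.1, max a.1 b.1, min a.2 b.2, max a.2 b.2⟩

/-- The grid point with the index pair `a`. -/
noncomputable def gridPt (xs ys : ℕ → ℝ) (a : ℕ × ℕ) : E2 := pt (xs a.1) (ys a.2)

/-! ### Boxes as sets of points and as sets of cells -/

section boxes

variable {xs ys : ℕ → ℝ}

lemma continuous_coord (i : Fin 2) : Continuous fun p : E2 => p i := by fun_prop

lemma Box.isClosed (B : Box) : IsClosed (B.toSet xs ys) := by
  have h0 := continuous_coord 0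
  have h1 := continuous_coord 1
  exact ((isClosed_le continuous_const h0).inter (isClosed_le h0 continuous_const)).inter
    ((isClosed_le continuous_const h1).inter (isClosed_le h1 continuous_const))

lemma continuous_pt : Continuous fun q : ℝ × ℝ => pt q.1 q.2 := by
  refine (PiLp.continuous_toLp 2 _).comp (continuous_pi fun i => ?_)
  fin_cases i
  · exact continuous_fst
  · exact continuous_snd

lemma Box.isCompact (B : Box) : IsCompact (B.toSet xs ys) := by
  have : B.toSet xs ys = (fun q : ℝ × ℝ => pt q.1 q.2) ''
      (Set.Icc (xs B.x₀) (xs B.x₁) ×ˢ Set.Icc (ys B.y₀) (ys B.y₁)) := by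
    ext p
    constructor
    · intro h
      exact ⟨(p 0, p 1), h, pt_eta p⟩
    · rintro ⟨q, hq, rfl⟩
      exact hq
  rw [this]
  exact (isCompact_Icc.prod isCompact_Icc).image continuous_pt

lemma Box.convex (B : Box) : Convex ℝ (B.toSet xs ys) := by
  intro p hp q hq a b ha hb hab
  obtain ⟨⟨h1, h2⟩, h3, h4⟩ := hp
  obtain ⟨⟨k1, k2⟩, k3, k4⟩ := hq
  exact ⟨convex_Icc _ _ ⟨h1, h2⟩ ⟨k1, k2⟩ ha hb hab, convex_Icc _ _ ⟨h3, h4⟩ ⟨k3, k4⟩ ha hb hab⟩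

variable (hx : StrictMono xs) (hy : StrictMono ys)

include hx hy

lemma Box.mem_iff_hasCell {d e : ℕ} {p : E2} (hd : Cell xs d (p 0)) (he : Cell ys e (p 1))
    (B : Box) : p ∈ B.toSet xs ys ↔ B.HasCell d e := by
  unfold Box.toSet Box.HasCell
  simp only [Set.mem_ofPred_eq, cell_ge_iff hx hd, cell_le_iff hx hd, cell_ge_iff hy he,
    cell_le_iff hy he]

lemma Box.toSet_inter (A B : Box) :
    (A.inter B).toSet xs ys = A.toSet xs ys ∩ B.toSet xs ys := by
  ext p
  simp only [Box.toSet, Box.inter, hx.monotone.map_max, hx.monotone.map_min,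
    hy.monotone.map_max, hy.monotone.map_min, Set.mem_inter_iff, Set.mem_ofPred_eq, max_le_iff,
    le_min_iff]
  tauto

lemma Box.toSet_eq_empty {B : Box} (h : B.IsVoid) : B.toSet xs ys = ∅ := by
  ext p
  simp only [Box.toSet, Set.mem_ofPred_eq, Set.mem_empty_iff_false, iff_false]
  rintro ⟨⟨h1, h2⟩, h3, h4⟩
  rcases h with h | h
  · exact (hx h).not_ge (h1.trans h2)
  · exact (hy h).not_ge (h3.trans h4)

lemma gridPt_injective : Function.Injective (gridPt xs ys) := by
  intro a b h
  have h0 := congrArg (fun p : E2 => p 0) h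
  have h1 := congrArg (fun p : E2 => p 1) h
  exact Prod.ext (hx.injective h0) (hy.injective h1)

omit hx hy in
lemma Box.toSet_point (a : ℕ × ℕ) :
    (⟨a.1, a.1, a.2, a.2⟩ : Box).toSet xs ys = {gridPt xs ys a} := by
  ext p
  constructor
  · rintro ⟨⟨h1, h2⟩, h3, h4⟩
    exact E2_ext (le_antisymm h2 h1) (le_antisymm h4 h3)
  · rintro rfl
    exact ⟨⟨le_rfl, le_rfl⟩, le_rfl, le_rfl⟩

/-- One coordinate is constant along the segment, so the convex weights found for the other
coordinate serve for both; without this hypothesis the segment would only be a diagonal of the box.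
-/
lemma segment_gridPt {a b : ℕ × ℕ} (h : a.1 = b.1 ∨ a.2 = b.2) :
    segment ℝ (gridPt xs ys a) (gridPt xs ys b) = (spanBox a b).toSet xs ys := by
  have key : (spanBox a b).toSet xs ys =
      {p | p 0 ∈ segment ℝ (xs a.1) (xs b.1) ∧ p 1 ∈ segment ℝ (ys a.2) (ys b.2)} := by
    simp only [segment_eq_uIcc, Set.uIcc, Set.mem_Icc, spanBox, Box.toSet, hx.monotone.map_max,
      hx.monotone.map_min, hy.monotone.map_max, hy.monotone.map_min]
  rw [key]
  ext p
  constructor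
  · rintro ⟨s, t, hs, ht, hst, rfl⟩
    exact ⟨⟨s, t, hs, ht, hst, rfl⟩, ⟨s, t, hs, ht, hst, rfl⟩⟩
  · rintro ⟨⟨s, t, hs, ht, hst, h0⟩, ⟨s', t', hs', ht', hst', h1⟩⟩
    rcases h with h | h
    · refine ⟨s', t', hs', ht', hst', E2_ext ?_ h1⟩
      rw [← h0, ← h]
      simp only [gridPt, PiLp.add_apply, PiLp.smul_apply, pt_zero, ← h, smul_eq_mul, ← add_mul,
        hst, hst']
    · refine ⟨s, t, hs, ht, hst, E2_ext h0 ?_⟩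
      rw [← h1, ← h]
      simp only [gridPt, PiLp.add_apply, PiLp.smul_apply, pt_one, ← h, smul_eq_mul, ← add_mul,
        hst, hst']

end boxes

/-! ### Grid polygons and the regions that they enclose -/

/-- The index after `i` in the cyclic order of `0, …, n - 1`. -/
def cyc (n i : ℕ) : ℕ := if i + 1 = n then 0 else i + 1

lemma val_finRotate {n : ℕ} (i : Fin n) : (finRotate n i : ℕ) = cyc n i := by
  obtain _ | n := n
  · exact i.elim0
  · rw [finRotate_apply, Fin.val_add_one, cyc]
    simp only [Fin.ext_iff, Fin.val_last, Nat.add_right_cancel_iff]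

lemma cyc_lt {n i : ℕ} (h : i < n) : cyc n i < n := by
  unfold cyc; split_ifs <;> omega

/-- The closed polygon through the grid points `c 0, …, c (n - 1)`. -/
noncomputable def gridPolygon (xs ys : ℕ → ℝ) (n : ℕ) (c : ℕ → ℕ × ℕ) : Polygon E2 n :=
  ⟨fun i => gridPt xs ys (c i)⟩

/-- The side of a grid polygon that begins at `c i`, as a box. -/
def sideBox (n : ℕ) (c : ℕ → ℕ × ℕ) (i : ℕ) : Box := spanBox (c i) (c (cyc n i))

/-- The sides of a grid polygon, as boxes. -/
def sideBoxes (n : ℕ) (c : ℕ → ℕ × ℕ) : List Box := (List.range n).map (sideBox n c)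

/-- The cells of a box in the column `d`, as a bit mask. -/
def Box.mask (B : Box) (d : ℕ) : ℕ :=
  -- The ones occupy the positions from `2 * y₀` to `2 * y₁`. If `y₁ < y₀`, the truncated exponent
  -- is 0 and the mask vanishes, as it should for a void box.
  if 2 * B.x₀ ≤ d ∧ d ≤ 2 * B.x₁ then (2 ^ (2 * B.y₁ + 1 - 2 * B.y₀) - 1) <<< (2 * B.y₀) else 0

lemma Box.testBit_mask {B : Box} {d e : ℕ} : (B.mask d).testBit e = true ↔ B.HasCell d e := by
  unfold Box.mask Box.HasCell
  split_ifs with h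
  · simp only [Nat.testBit_shiftLeft, Nat.testBit_two_pow_sub_one, Bool.and_eq_true,
      decide_eq_true_eq, h, true_and, and_self]
    omega
  · simp [h]

/-- Whether the cell `(d, e)` lies in one of the boxes `bs`. -/
def cellIn (bs : List Box) (d e : ℕ) : Bool :=
  (bs.foldr (fun (B : Box) n => B.mask d ||| n) 0).testBit e

lemma cellIn_iff {bs : List Box} {d e : ℕ} : cellIn bs d e = true ↔ ∃ B ∈ bs, B.HasCell d e := by
  unfold cellIn
  induction bs with
  | nil => simp
  | cons B bs ih => simp [Nat.testBit_or, Box.testBit_mask, ih]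

/-- The conditions under which `c 0, …, c (n - 1)` are the corners of a simple orthogonal polygon
that encloses the union of the boxes `bs` on a grid with the indices `0, …, m`. -/
structure IsGridNet (n : ℕ) (c : ℕ → ℕ × ℕ) (m : ℕ) (bs : List Box) : Prop where
  three_le : 3 ≤ n
  turn : ∀ i < n, ((c i).1 = (c (cyc n i)).1 ∧ (c (cyc n i)).2 = (c (cyc n (cyc n i))).2) ∨
    ((c i).2 = (c (cyc n i)).2 ∧ (c (cyc n i)).1 = (c (cyc n (cyc n i))).1)
  distinct : ∀ i < n, ∀ j < i, c i ≠ c j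
  consecutive : ∀ i < n, (sideBox n c i).inter (sideBox n c (cyc n i)) =
    ⟨(c (cyc n i)).1, (c (cyc n i)).1, (c (cyc n i)).2, (c (cyc n i)).2⟩
  disjoint : ∀ i < n, ∀ j < i, cyc n i ≠ j → cyc n j ≠ i →
    ((sideBox n c i).inter (sideBox n c j)).IsVoid
  corner_lt : ∀ i < n, (c i).1 < m ∧ (c i).2 < m
  -- The margin of one grid line keeps all cells of the boxes away from the ends of the grid, where
  -- `d - 1` in `nearCells` would be truncated.
  box_le : ∀ B ∈ bs, (1 ≤ B.x₀ ∧ B.x₁ < m) ∧ 1 ≤ B.y₀ ∧ B.y₁ < m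
  proper : ∃ B ∈ bs, B.x₀ < B.x₁ ∧ B.y₀ < B.y₁
  -- A cell belongs to a side exactly when it lies in the union while some cell near it does not.
  frontier_cell : ∀ d < 2 * m, ∀ e < 2 * m, cellIn (sideBoxes n c) d e = (cellIn bs d e &&
    !((nearCells d).all fun d' => (nearCells e).all fun e' => cellIn bs d' e'))

/-- The union of the rectangles of some boxes. -/
def boxUnion (xs ys : ℕ → ℝ) (bs : List Box) : Set E2 := ⋃ B ∈ bs, B.toSet xs ys

lemma isCompact_boxUnion (xs ys : ℕ → ℝ) (bs : List Box) : IsCompact (boxUnion xs ys bs) := by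
  have h : {B | B ∈ bs}.Finite := List.finite_toSet bs
  exact h.isCompact_biUnion fun B _ => B.isCompact

namespace IsGridNet

variable {n : ℕ} {c : ℕ → ℕ × ℕ} {m : ℕ} {bs : List Box} {xs ys : ℕ → ℝ}
  (H : IsGridNet n c m bs) (hx : StrictMono xs) (hy : StrictMono ys)

include H hx hy

omit hx hy in
lemma side_eq {i : ℕ} (hi : i < n) : (c i).1 = (c (cyc n i)).1 ∨ (c i).2 = (c (cyc n i)).2 :=
  (H.turn i hi).imp And.left And.left

lemma edgeSet_eq (i : Fin n) :
    (gridPolygon xs ys n c).edgeSet ℝ i = (sideBox n c i).toSet xs ys := by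
  rw [Polygon.edgeSet, affineSegment_eq_segment]
  simp only [gridPolygon, val_finRotate]
  exact segment_gridPt hx hy (H.side_eq i.2)

lemma isSimple : IsSimple (gridPolygon xs ys n c) where
  three_le := H.three_le
  injective := by
    intro i j h
    have h := gridPt_injective hx hy h
    rcases lt_trichotomy i j with h' | h' | h'
    · exact absurd h.symm (H.distinct j j.2 i h')
    · exact h'
    · exact absurd h (H.distinct i i.2 j h')
  consecutive i := by
    rw [H.edgeSet_eq hx hy, H.edgeSet_eq hx hy, ← Box.toSet_inter hx hy, val_finRotate,
      H.consecutive i i.2, Box.toSet_point]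
    simp only [gridPolygon, val_finRotate]
  disjoint := by
    have key : ∀ i j : Fin n, j < i → cyc n i ≠ j → cyc n j ≠ i →
        Disjoint ((gridPolygon xs ys n c).edgeSet ℝ i) ((gridPolygon xs ys n c).edgeSet ℝ j) := by
      intro i j h h1 h2
      rw [H.edgeSet_eq hx hy, H.edgeSet_eq hx hy, Set.disjoint_iff_inter_eq_empty,
        ← Box.toSet_inter hx hy]
      exact Box.toSet_eq_empty hx hy (H.disjoint i i.2 j h h1 h2)
    intro i j hij h1 h2
    have h1' : cyc n i ≠ j := fun h => h1 (Fin.ext (by rw [val_finRotate, h]))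
    have h2' : cyc n j ≠ i := fun h => h2 (Fin.ext (by rw [val_finRotate, h]))
    rcases lt_or_gt_of_ne hij with h | h
    · exact (key j i h h2' h1').symm
    · exact key i j h h1' h2'

omit hx hy in
lemma hasRightAngles : HasRightAngles (gridPolygon xs ys n c) := by
  intro i
  have h := H.turn i i.2
  simp only [gridPolygon, val_finRotate]
  rw [EuclideanSpace.inner_eq_star_dotProduct]
  simp only [dotProduct, Fin.sum_univ_two, gridPt]
  rcases h with ⟨h1, h2⟩ | ⟨h1, h2⟩ <;> simp [h1, h2]

lemma boundary_eq :
    (gridPolygon xs ys n c).boundary ℝ = ⋃ i : Fin n, (sideBox n c i).toSet xs ys := by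
  simp only [Polygon.boundary, H.edgeSet_eq hx hy]

omit H in
lemma mem_region_iff {d e : ℕ} {p : E2} (hd : Cell xs d (p 0)) (he : Cell ys e (p 1)) :
    p ∈ boxUnion xs ys bs ↔ cellIn bs d e = true := by
  rw [cellIn_iff]
  simp only [boxUnion, Set.mem_iUnion, Box.mem_iff_hasCell hx hy hd he, exists_prop]

lemma mem_boundary_iff {d e : ℕ} {p : E2} (hd : Cell xs d (p 0)) (he : Cell ys e (p 1)) :
    p ∈ (gridPolygon xs ys n c).boundary ℝ ↔ cellIn (sideBoxes n c) d e = true := by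
  rw [cellIn_iff, H.boundary_eq hx hy]
  simp only [sideBoxes, List.mem_map, List.mem_range, exists_exists_and_eq_and,
    Set.mem_iUnion, Box.mem_iff_hasCell hx hy hd he]
  exact ⟨fun ⟨i, hi⟩ => ⟨i, i.2, hi⟩, fun ⟨i, h, hi⟩ => ⟨⟨i, h⟩, hi⟩⟩

-- If a near cell misses the union, then `p`, which is in the closure of that cell, is in the
-- closure of the complement. Conversely the near cells fill a neighbourhood of `p`.
omit H in
lemma mem_interior_iff {d e : ℕ} {p : E2} (hd : Cell xs d (p 0)) (he : Cell ys e (p 1))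
    (hd' : 0 < d) (he' : 0 < e) :
    p ∈ interior (boxUnion xs ys bs) ↔
      ∀ d' ∈ nearCells d, ∀ e' ∈ nearCells e, cellIn bs d' e' = true := by
  constructor
  · intro hp d' hd1 e' he1
    by_contra hT
    have h0 : ((p 0, p 1) : ℝ × ℝ) ∈ closure ({u | Cell xs d' u} ×ˢ {v | Cell ys e' v}) := by
      rw [closure_prod_eq]
      exact ⟨mem_closure_cell hx hd' hd hd1, mem_closure_cell hy he' he he1⟩
    have h1 := map_mem_closure (t := (boxUnion xs ys bs)ᶜ) continuous_pt h0 fun q hq hq' =>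
      hT ((mem_region_iff hx hy (p := pt q.1 q.2) hq.1 hq.2).1 hq')
    rw [pt_eta, closure_compl] at h1
    exact h1 hp
  · intro h
    rw [mem_interior_iff_mem_nhds]
    have hc0 := (continuous_coord 0).tendsto p
    have hc1 := (continuous_coord 1).tendsto p
    filter_upwards [hc0.eventually (eventually_near hx hd' hd),
      hc1.eventually (eventually_near hy he' he)] with q ⟨d', hd1, hd2⟩ ⟨e', he1, he2⟩
    exact (mem_region_iff hx hy hd2 he2).2 (h d' hd1 e' he1)

lemma exists_cells_of_mem {B : Box} (hB : B ∈ bs) {p : E2} (hp : p ∈ B.toSet xs ys) :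
    ∃ d e, Cell xs d (p 0) ∧ Cell ys e (p 1) ∧ (0 < d ∧ d ≤ 2 * (m - 1)) ∧
      0 < e ∧ e ≤ 2 * (m - 1) := by
  obtain ⟨⟨b1, b2⟩, b3, b4⟩ := H.box_le B hB
  obtain ⟨⟨h1, h2⟩, h3, h4⟩ := hp
  obtain ⟨d, hd, hd'⟩ := exists_cell ((hx.monotone (Nat.zero_le _)).trans h1)
    (h2.trans (hx.monotone (by omega : B.x₁ ≤ m - 1)))
  obtain ⟨e, he, he'⟩ := exists_cell ((hy.monotone (Nat.zero_le _)).trans h3)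
    (h4.trans (hy.monotone (by omega : B.y₁ ≤ m - 1)))
  have k1 := (cell_ge_iff hx hd' _).1 h1
  have k3 := (cell_ge_iff hy he' _).1 h3
  exact ⟨d, e, hd', he', ⟨by omega, hd⟩, by omega, he⟩

omit hx hy in
lemma frontier_cell_iff {d e : ℕ} (hd : d < 2 * m) (he : e < 2 * m) :
    cellIn (sideBoxes n c) d e = true ↔ cellIn bs d e = true ∧
      ¬ ∀ d' ∈ nearCells d, ∀ e' ∈ nearCells e, cellIn bs d' e' = true := by
  rw [H.frontier_cell d hd e he, Bool.and_eq_true, Bool.not_eq_true', ← Bool.not_eq_true,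
    List.all_eq_true]
  simp only [List.all_eq_true]

/-- The region is compact, hence closed, so its frontier is the region minus its interior; both are
decided by cells, and `frontier_cell` compares the result with the sides. -/
lemma frontier_eq :
    frontier (boxUnion xs ys bs) = (gridPolygon xs ys n c).boundary ℝ := by
  rw [(isCompact_boxUnion xs ys bs).isClosed.frontier_eq]
  ext p
  constructor
  · rintro ⟨hp, hi⟩
    obtain ⟨B, hB, hp'⟩ : ∃ B ∈ bs, p ∈ B.toSet xs ys := by simpa [boxUnion] using hp
    obtain ⟨d, e, hd, he, hd', he'⟩ := H.exists_cells_of_mem hx hy hB hp'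
    have hd2 : d < 2 * m := by omega
    have he2 : e < 2 * m := by omega
    rw [mem_interior_iff hx hy hd he hd'.1 he'.1] at hi
    rw [H.mem_boundary_iff hx hy hd he, H.frontier_cell_iff hd2 he2]
    exact ⟨(mem_region_iff hx hy hd he).1 hp, hi⟩
  · intro hp
    have hp' := hp
    rw [H.boundary_eq hx hy, Set.mem_iUnion] at hp'
    obtain ⟨i, ⟨h1, h2⟩, h3, h4⟩ := hp'
    have c1 := H.corner_lt i i.2
    have c2 := H.corner_lt _ (cyc_lt i.2)
    simp only [sideBox, spanBox] at h1 h2 h3 h4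
    obtain ⟨d, hd', hd⟩ := exists_cell ((hx.monotone (Nat.zero_le _)).trans h1)
      (h2.trans (hx.monotone (by omega : _ ≤ m - 1)))
    obtain ⟨e, he', he⟩ := exists_cell ((hy.monotone (Nat.zero_le _)).trans h3)
      (h4.trans (hy.monotone (by omega : _ ≤ m - 1)))
    have hd2 : d < 2 * m := by omega
    have he2 : e < 2 * m := by omega
    rw [H.mem_boundary_iff hx hy hd he, H.frontier_cell_iff hd2 he2] at hp
    have hN := (mem_region_iff hx hy hd he).2 hp.1
    refine ⟨hN, ?_⟩
    obtain ⟨B, hB, hc⟩ := cellIn_iff.1 hp.1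
    obtain ⟨⟨b1, b2⟩, b3, b4⟩ := H.box_le B hB
    obtain ⟨⟨k1, k2⟩, k3, k4⟩ := hc
    -- The box that contains the cell begins at index 1 or later in both directions, which makes `d`
    -- and `e` positive.
    rw [mem_interior_iff hx hy hd he (by omega) (by omega)]
    exact hp.2

lemma interior_nonempty : (interior (boxUnion xs ys bs)).Nonempty := by
  obtain ⟨B, hB, h1, h2⟩ := H.proper
  obtain ⟨u, hu⟩ := exists_between (hx h1)
  obtain ⟨v, hv⟩ := exists_between (hy h2)
  refine ⟨pt u v, mem_interior_iff_mem_nhds.2 ?_⟩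
  have hc0 := (continuous_coord 0).tendsto (pt u v)
  have hc1 := (continuous_coord 1).tendsto (pt u v)
  filter_upwards [hc0 (Ioo_mem_nhds hu.1 hu.2), hc1 (Ioo_mem_nhds hv.1 hv.2)] with q hq0 hq1
  exact Set.mem_biUnion hB ⟨⟨hq0.1.le, hq0.2.le⟩, hq1.1.le, hq1.2.le⟩

theorem isOrthogonalNet : IsOrthogonalNet (gridPolygon xs ys n c) (boxUnion xs ys bs) where
  simple := H.isSimple hx hy
  rightAngles := H.hasRightAngles
  region := ⟨isCompact_boxUnion xs ys bs, H.interior_nonempty hx hy, H.frontier_eq hx hy⟩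

end IsGridNet

/-- The box `A` is contained in the box `B`. -/
def Box.isSub (A B : Box) : Bool :=
  B.x₀.ble A.x₀ && A.x₁.ble B.x₁ && B.y₀.ble A.y₀ && A.y₁.ble B.y₁

lemma Box.subset_of_isSub {A B : Box} {xs ys : ℕ → ℝ} (hx : StrictMono xs) (hy : StrictMono ys)
    (h : A.isSub B = true) : A.toSet xs ys ⊆ B.toSet xs ys := by
  simp only [Box.isSub, Bool.and_eq_true, Nat.ble_eq] at h
  obtain ⟨⟨⟨h1, h2⟩, h3⟩, h4⟩ := h
  exact fun p hp => ⟨⟨(hx.monotone h1).trans hp.1.1, hp.1.2.trans (hx.monotone h2)⟩,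
    (hy.monotone h3).trans hp.2.1, hp.2.2.trans (hy.monotone h4)⟩

/-- A box in a side of the polygon lies in the frontier of the region. -/
lemma IsGridNet.subset_frontier {n : ℕ} {c : ℕ → ℕ × ℕ} {m : ℕ} {bs : List Box}
    {xs ys : ℕ → ℝ} (H : IsGridNet n c m bs) (hx : StrictMono xs) (hy : StrictMono ys) {A : Box}
    (hA : (sideBoxes n c).any A.isSub = true) :
    A.toSet xs ys ⊆ frontier (boxUnion xs ys bs) := by
  simp only [sideBoxes, List.any_eq_true, List.mem_map, List.mem_range] at hA
  obtain ⟨_, ⟨i, hi, rfl⟩, h⟩ := hA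
  rw [H.frontier_eq hx hy, H.boundary_eq hx hy]
  exact (Box.subset_of_isSub hx hy h).trans
    (Set.subset_iUnion (fun i : Fin n => (sideBox n c i).toSet xs ys) ⟨i, hi⟩)

/-! ### Rectangles -/

/-- A rectangle in the plane can be carried onto any congruent rectangle in space. -/
lemma exists_isometry_rect (P : Fin 4 → E2) (Q : Fin 4 → E3) (hP : P 2 - P 1 = P 3 - P 0)
    (hQ : Q 2 - Q 1 = Q 3 - Q 0) (h1 : ‖P 1 - P 0‖ = ‖Q 1 - Q 0‖) (h3 : ‖P 3 - P 0‖ = ‖Q 3 - Q 0‖)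
    (n1 : ‖P 1 - P 0‖ ≠ 0) (n3 : ‖P 3 - P 0‖ ≠ 0) (oP : inner ℝ (P 1 - P 0) (P 3 - P 0) = 0)
    (oQ : inner ℝ (Q 1 - Q 0) (Q 3 - Q 0) = 0) : ∃ φ : E2 →ᵃⁱ[ℝ] E3, ∀ j, φ (P j) = Q j := by
  set w := ‖P 1 - P 0‖
  set h := ‖P 3 - P 0‖
  have hA : Orthonormal ℝ ![w⁻¹ • (P 1 - P 0), h⁻¹ • (P 3 - P 0)] := by
    rw [orthonormal_vecCons_iff]
    refine ⟨?_, ?_, ?_⟩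
    · rw [norm_smul, norm_inv, norm_norm]; exact inv_mul_cancel₀ n1
    · intro i; fin_cases i
      simp [inner_smul_left, inner_smul_right, oP]
    · rw [orthonormal_vecCons_iff]
      refine ⟨?_, fun i => i.elim0, ⟨fun i => i.elim0, fun i => i.elim0⟩⟩
      rw [norm_smul, norm_inv, norm_norm]; exact inv_mul_cancel₀ n3
  have hB : Orthonormal ℝ ![w⁻¹ • (Q 1 - Q 0), h⁻¹ • (Q 3 - Q 0)] := by
    rw [orthonormal_vecCons_iff]
    refine ⟨?_, ?_, ?_⟩
    · rw [norm_smul, norm_inv, ← h1, norm_norm]; exact inv_mul_cancel₀ n1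
    · intro i; fin_cases i
      simp [inner_smul_left, inner_smul_right, oQ]
    · rw [orthonormal_vecCons_iff]
      refine ⟨?_, fun i => i.elim0, ⟨fun i => i.elim0, fun i => i.elim0⟩⟩
      rw [norm_smul, norm_inv, ← h3, norm_norm]; exact inv_mul_cancel₀ n3
  -- The normalised sides at corner 0 form a basis of the plane; sending them to the normalised
  -- sides in space preserves orthonormality, so the linear map is an isometry. Corner 2 then
  -- follows from the parallelogram laws.
  let b := basisOfOrthonormalOfCardEqFinrank hA (by simp)
  have hb : ∀ i, b i = ![w⁻¹ • (P 1 - P 0), h⁻¹ • (P 3 - P 0)] i := fun i => by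
    simp [b]
  let f := b.constr ℝ ![w⁻¹ • (Q 1 - Q 0), h⁻¹ • (Q 3 - Q 0)]
  have hf : ∀ i, f (b i) = ![w⁻¹ • (Q 1 - Q 0), h⁻¹ • (Q 3 - Q 0)] i :=
    fun i => b.constr_basis ℝ _ i
  let g : E2 →ₗᵢ[ℝ] E3 := f.isometryOfOrthonormal (v := b)
    (by rwa [show (b : Fin 2 → E2) = _ from funext hb])
    (by rwa [show (f ∘ b : Fin 2 → E3) = _ from funext hf])
  have g1 : g (P 1 - P 0) = Q 1 - Q 0 := by
    have := hf 0
    rw [hb 0] at this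
    simp only [Matrix.cons_val_zero, map_smul] at this
    exact smul_right_injective _ (inv_ne_zero n1) this
  have g3 : g (P 3 - P 0) = Q 3 - Q 0 := by
    have := hf 1
    rw [hb 1] at this
    simp only [Matrix.cons_val_one, Matrix.cons_val_zero, map_smul] at this
    exact smul_right_injective _ (inv_ne_zero n3) this
  refine ⟨⟨AffineMap.mk' (fun x => g (x - P 0) + Q 0) g.toLinearMap (P 0) (fun x => by simp),
    fun x => by simp⟩, fun j => ?_⟩
  change g (P j - P 0) + Q 0 = Q j
  fin_cases j
  · simp
  · simp [g1]
  · have : P 2 - P 0 = (P 1 - P 0) + (P 3 - P 0) := by rw [← hP]; abel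
    change g (P 2 - P 0) + Q 0 = Q 2
    rw [this, map_add, g1, g3, ← hQ]; abel
  · simp [g3]

/-- The grid points `c 0, …, c 3` are the corners of the box `B`, in cyclic order. -/
def IsCornerCycle (B : Box) (c : Fin 4 → ℕ × ℕ) : Prop :=
  B = spanBox (c 0) (c 2) ∧
    ((c 1 = ((c 2).1, (c 0).2) ∧ c 3 = ((c 0).1, (c 2).2)) ∨
      (c 1 = ((c 0).1, (c 2).2) ∧ c 3 = ((c 2).1, (c 0).2)))

instance (B : Box) (c : Fin 4 → ℕ × ℕ) : Decidable (IsCornerCycle B c) := by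
  unfold IsCornerCycle; infer_instance

lemma pt_mem_segment_left {x x₁ x₂ : ℝ} (h : x ∈ segment ℝ x₁ x₂) (y : ℝ) :
    pt x y ∈ segment ℝ (pt x₁ y) (pt x₂ y) := by
  obtain ⟨a, b, ha, hb, hab, rfl⟩ := h
  exact ⟨a, b, ha, hb, hab, E2_ext (by simp) (by simp [← add_mul, hab])⟩

lemma pt_mem_segment_right {y y₁ y₂ : ℝ} (x : ℝ) (h : y ∈ segment ℝ y₁ y₂) :
    pt x y ∈ segment ℝ (pt x y₁) (pt x y₂) := by
  obtain ⟨a, b, ha, hb, hab, rfl⟩ := h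
  exact ⟨a, b, ha, hb, hab, E2_ext (by simp [← add_mul, hab]) (by simp)⟩

section

variable {xs ys : ℕ → ℝ} (hx : StrictMono xs) (hy : StrictMono ys)

include hx hy

/-- A point of the box lies on a vertical segment whose ends are on the two horizontal sides, and
these ends are convex combinations of corners. -/
lemma IsCornerCycle.convexHull_eq {B : Box} {c : Fin 4 → ℕ × ℕ} (h : IsCornerCycle B c) :
    convexHull ℝ (Set.range fun j => gridPt xs ys (c j)) = B.toSet xs ys := by
  obtain ⟨rfl, h⟩ := h
  set K := convexHull ℝ (Set.range fun j => gridPt xs ys (c j))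
  have hK : Convex ℝ K := convex_convexHull _ _
  have hm : ∀ j, gridPt xs ys (c j) ∈ K := fun j => subset_convexHull _ _ ⟨j, rfl⟩
  apply Set.Subset.antisymm
  · refine convexHull_min ?_ (Box.convex _)
    rintro _ ⟨j, rfl⟩
    have hc : c j = ((c 0).1, (c 0).2) ∨ c j = ((c 0).1, (c 2).2) ∨ c j = ((c 2).1, (c 0).2) ∨
        c j = ((c 2).1, (c 2).2) := by
      fin_cases j
      · exact Or.inl rfl
      · rcases h with h | h <;> simp [h.1]
      · exact Or.inr (Or.inr (Or.inr rfl))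
      · rcases h with h | h <;> simp [h.2]
    have l1 := hx.monotone (min_le_left (c 0).1 (c 2).1)
    have l2 := hx.monotone (min_le_right (c 0).1 (c 2).1)
    have l3 := hx.monotone (le_max_left (c 0).1 (c 2).1)
    have l4 := hx.monotone (le_max_right (c 0).1 (c 2).1)
    have k1 := hy.monotone (min_le_left (c 0).2 (c 2).2)
    have k2 := hy.monotone (min_le_right (c 0).2 (c 2).2)
    have k3 := hy.monotone (le_max_left (c 0).2 (c 2).2)
    have k4 := hy.monotone (le_max_right (c 0).2 (c 2).2)
    change gridPt xs ys (c j) ∈ _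
    rcases hc with hc | hc | hc | hc <;> rw [hc]
    exacts [⟨⟨l1, l3⟩, k1, k3⟩, ⟨⟨l1, l3⟩, k2, k4⟩, ⟨⟨l2, l4⟩, k1, k3⟩, ⟨⟨l2, l4⟩, k2, k4⟩]
  · rintro p ⟨h0, h1⟩
    have h0' : p 0 ∈ segment ℝ (xs (c 0).1) (xs (c 2).1) := by
      rw [segment_eq_uIcc, Set.uIcc, Set.mem_Icc, ← hx.monotone.map_min, ← hx.monotone.map_max]
      exact h0
    have h1' : p 1 ∈ segment ℝ (ys (c 0).2) (ys (c 2).2) := by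
      rw [segment_eq_uIcc, Set.uIcc, Set.mem_Icc, ← hy.monotone.map_min, ← hy.monotone.map_max]
      exact h1
    have hq : gridPt xs ys ((c 2).1, (c 0).2) ∈ K ∧ gridPt xs ys ((c 0).1, (c 2).2) ∈ K := by
      rcases h with h | h
      · exact ⟨h.1 ▸ hm 1, h.2 ▸ hm 3⟩
      · exact ⟨h.2 ▸ hm 3, h.1 ▸ hm 1⟩
    have m0 : pt (p 0) (ys (c 0).2) ∈ K :=
      hK.segment_subset (hm 0) hq.1 (pt_mem_segment_left h0' _)
    have m1 : pt (p 0) (ys (c 2).2) ∈ K :=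
      hK.segment_subset hq.2 (hm 2) (pt_mem_segment_left h0' _)
    exact pt_eta p ▸ hK.segment_subset m0 m1 (pt_mem_segment_right _ h1')

end

lemma affineIsometry_image_convexHull {ι : Type*} (φ : E2 →ᵃⁱ[ℝ] E3) (P : ι → E2) :
    φ '' convexHull ℝ (Set.range P) = convexHull ℝ (Set.range fun j => φ (P j)) := by
  have := φ.toAffineMap.image_convexHull (Set.range P)
  rw [← Set.range_comp] at this
  exact this

/-- The model of a single rectangle. After the two axes are scaled by the side lengths, it serves
for every face, so that faces and net use the same plane topology. -/
lemma isGridNet_rect : IsGridNet 4 ([(1, 1), (2, 1), (2, 2), (1, 2)].getD · (0, 0)) 3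
    [⟨1, 2, 1, 2⟩] := by
  constructor <;> decide +kernel

/-- A rectangle in space is a simple planar polygon that encloses its convex hull. -/
lemma isPlanarPolygon_rect (Q : Fin 4 → E3) (hQ : Q 2 - Q 1 = Q 3 - Q 0) (n1 : Q 1 ≠ Q 0)
    (n3 : Q 3 ≠ Q 0) (oQ : inner ℝ (Q 1 - Q 0) (Q 3 - Q 0) = 0) :
    IsPlanarPolygon ⟨Q⟩ (convexHull ℝ (Set.range Q)) := by
  have hw : 0 < ‖Q 1 - Q 0‖ := norm_pos_iff.2 (sub_ne_zero.2 n1)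
  have hh : 0 < ‖Q 3 - Q 0‖ := norm_pos_iff.2 (sub_ne_zero.2 n3)
  set w := ‖Q 1 - Q 0‖
  set h := ‖Q 3 - Q 0‖
  have hx : StrictMono fun i : ℕ => (i : ℝ) * w :=
    fun i j hij => mul_lt_mul_of_pos_right (Nat.cast_lt.2 hij) hw
  have hy : StrictMono fun i : ℕ => (i : ℝ) * h :=
    fun i j hij => mul_lt_mul_of_pos_right (Nat.cast_lt.2 hij) hh
  have H := isGridNet_rect.isOrthogonalNet hx hy
  set c : ℕ → ℕ × ℕ := ([(1, 1), (2, 1), (2, 2), (1, 2)].getD · (0, 0)) with hc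
  let P : Fin 4 → E2 := fun j => gridPt (fun i : ℕ => (i : ℝ) * w) (fun i : ℕ => (i : ℝ) * h) (c j)
  have P1 : P 1 - P 0 = pt w 0 := by
    refine E2_ext ?_ ?_ <;> simp [P, c, gridPt]; ring
  have P3 : P 3 - P 0 = pt 0 h := by
    refine E2_ext ?_ ?_ <;> simp [P, c, gridPt]; ring
  have P2 : P 2 - P 1 = pt 0 h := by
    refine E2_ext ?_ ?_ <;> simp [P, c, gridPt]; ring
  have N1 : ‖pt w 0‖ = w := by
    simp [EuclideanSpace.norm_eq, Fin.sum_univ_two, Real.sqrt_sq hw.le]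
  have N3 : ‖pt 0 h‖ = h := by
    simp [EuclideanSpace.norm_eq, Fin.sum_univ_two, Real.sqrt_sq hh.le]
  obtain ⟨φ, hφ⟩ := exists_isometry_rect P Q (P2.trans P3.symm) hQ (by rw [P1, N1]) (by rw [P3, N3])
    (by rw [P1, N1]; exact hw.ne') (by rw [P3, N3]; exact hh.ne')
    (by rw [P1, P3, EuclideanSpace.inner_eq_star_dotProduct]; simp [dotProduct, Fin.sum_univ_two])
    oQ
  have hB : IsCornerCycle ⟨1, 2, 1, 2⟩ fun j => c j := by rw [hc]; decide
  refine ⟨φ, _, _, H.simple, H.region, fun i => (hφ i).symm, ?_⟩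
  have := affineIsometry_image_convexHull φ P
  simp only [hφ] at this
  rw [← this, hB.convexHull_eq hx hy]
  simp [boxUnion]

/-! ### The combinatorics of the polyhedron

Vertices and faces are numbered, so that finite checks become computations with natural numbers. -/

/-- The bit that encodes a sign. -/
def bit (u : ℤˣ) : ℕ := if u = 1 then 0 else 1

/-- The sign that is encoded by a bit. -/
def unbit (n : ℕ) : ℤˣ := if n % 2 = 0 then 1 else -1

/-- The number of a vertex. -/
def Vertex.code : Vertex → ℕ
  | .apex k u => 2 * k + bit u
  | .base k s => 6 + 8 * k + (4 * bit (s 0) + 2 * bit (s 1) + bit (s 2))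
  | .top k s => 30 + 8 * k + (4 * bit (s 0) + 2 * bit (s 1) + bit (s 2))

/-- The vertex with a given number. -/
def vertexOf (n : ℕ) : Vertex :=
  if n < 6 then .apex (Fin.ofNat 3 (n / 2)) (unbit n)
  else if n < 30 then .base (Fin.ofNat 3 ((n - 6) / 8))
    ![unbit ((n - 6) / 4), unbit ((n - 6) / 2), unbit (n - 6)]
  else .top (Fin.ofNat 3 ((n - 30) / 8))
    ![unbit ((n - 30) / 4), unbit ((n - 30) / 2), unbit (n - 30)]

/-- The number of a face. -/
def Face.code : Face → ℕ
  | .inner k t a c => 8 * k + (4 * bit t + 2 * bit a + bit c)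
  | .outer k a c => 24 + 4 * k + (2 * bit a + bit c)
  | .side₁ k a c => 36 + 4 * k + (2 * bit a + bit c)
  | .side₂ k a c => 48 + 4 * k + (2 * bit a + bit c)
  | .lid k t => 60 + 2 * k + bit t

/-- The face with a given number. -/
def faceOf (n : ℕ) : Face :=
  if n < 24 then .inner (Fin.ofNat 3 (n / 8)) (unbit (n / 4)) (unbit (n / 2)) (unbit n)
  else if n < 36 then .outer (Fin.ofNat 3 ((n - 24) / 4)) (unbit (n / 2)) (unbit n)
  else if n < 48 then .side₁ (Fin.ofNat 3 ((n - 36) / 4)) (unbit (n / 2)) (unbit n)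
  else if n < 60 then .side₂ (Fin.ofNat 3 ((n - 48) / 4)) (unbit (n / 2)) (unbit n)
  else .lid (Fin.ofNat 3 ((n - 60) / 2)) (unbit n)

/-- The numbers of the corners of the faces. -/
def cornerTable : List (List ℕ) := [
  [2, 4, 22, 14], [2, 5, 23, 15], [3, 4, 24, 16],
  [3, 5, 25, 17], [2, 4, 26, 18], [2, 5, 27, 19],
  [3, 4, 28, 20], [3, 5, 29, 21], [4, 0, 6, 22],
  [4, 1, 10, 26], [5, 0, 7, 23], [5, 1, 11, 27],
  [4, 0, 8, 24], [4, 1, 12, 28], [5, 0, 9, 25],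
  [5, 1, 13, 29], [0, 2, 14, 6], [0, 3, 16, 8],
  [1, 2, 18, 10], [1, 3, 20, 12], [0, 2, 15, 7],
  [0, 3, 17, 9], [1, 2, 19, 11], [1, 3, 21, 13],
  [14, 18, 26, 22], [15, 19, 27, 23], [16, 20, 28, 24],
  [17, 21, 29, 25], [22, 24, 8, 6], [26, 28, 12, 10],
  [23, 25, 9, 7], [27, 29, 13, 11], [6, 7, 15, 14],
  [8, 9, 17, 16], [10, 11, 19, 18], [12, 13, 21, 20],
  [14, 18, 42, 38], [15, 19, 43, 39], [16, 20, 44, 40],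
  [17, 21, 45, 41], [22, 24, 48, 46], [26, 28, 52, 50],
  [23, 25, 49, 47], [27, 29, 53, 51], [6, 7, 31, 30],
  [8, 9, 33, 32], [10, 11, 35, 34], [12, 13, 37, 36],
  [22, 26, 50, 46], [23, 27, 51, 47], [24, 28, 52, 48],
  [25, 29, 53, 49], [6, 8, 32, 30], [10, 12, 36, 34],
  [7, 9, 33, 31], [11, 13, 37, 35], [14, 15, 39, 38],
  [16, 17, 41, 40], [18, 19, 43, 42], [20, 21, 45, 44],
  [30, 31, 33, 32], [34, 35, 37, 36], [38, 42, 43, 39],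
  [40, 44, 45, 41], [46, 48, 52, 50], [47, 49, 53, 51]]

/-- The number of the corner `i` (modulo 4) of the face with the number `f`. -/
def cornerCode (f i : ℕ) : ℕ := (cornerTable.getD f []).getD (i % 4) 0

/-- The numbers of the neighbours of each vertex, in the cyclic order of its link. -/
def starTable : List (List ℕ) := [
  [2, 6, 4, 8, 3, 9, 5, 7], [2, 10, 4, 12, 3, 13, 5, 11], [0, 14, 4, 18, 1, 19, 5, 15],
  [0, 16, 4, 20, 1, 21, 5, 17], [0, 22, 2, 26, 1, 28, 3, 24], [0, 23, 2, 27, 1, 29, 3, 25],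
  [0, 22, 8, 30, 7, 14], [0, 23, 9, 31, 6, 15], [0, 24, 6, 32, 9, 16],
  [0, 25, 7, 33, 8, 17], [1, 26, 12, 34, 11, 18], [1, 27, 13, 35, 10, 19],
  [1, 28, 10, 36, 13, 20], [1, 29, 11, 37, 12, 21], [2, 22, 18, 38, 15, 6],
  [2, 23, 19, 39, 14, 7], [3, 24, 20, 40, 17, 8], [3, 25, 21, 41, 16, 9],
  [2, 26, 14, 42, 19, 10], [2, 27, 15, 43, 18, 11], [3, 28, 16, 44, 21, 12],
  [3, 29, 17, 45, 20, 13], [4, 14, 26, 46, 24, 6], [5, 15, 27, 47, 25, 7],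
  [4, 16, 28, 48, 22, 8], [5, 17, 29, 49, 23, 9], [4, 18, 22, 50, 28, 10],
  [5, 19, 23, 51, 29, 11], [4, 20, 24, 52, 26, 12], [5, 21, 25, 53, 27, 13],
  [6, 31, 32], [7, 30, 33], [8, 33, 30],
  [9, 32, 31], [10, 35, 36], [11, 34, 37],
  [12, 37, 34], [13, 36, 35], [14, 42, 39],
  [15, 43, 38], [16, 44, 41], [17, 45, 40],
  [18, 38, 43], [19, 39, 42], [20, 40, 45],
  [21, 41, 44], [22, 48, 50], [23, 49, 51],
  [24, 46, 52], [25, 47, 53], [26, 52, 46],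
  [27, 53, 47], [28, 50, 48], [29, 51, 49]]

/-- The numbers of the neighbours of the vertex with the number `v`, in cyclic order. -/
def star (v : ℕ) : List ℕ := starTable.getD v []

lemma forall_units {p : ℤˣ → Prop} (h1 : p 1) (h2 : p (-1)) (u : ℤˣ) : p u := by
  rcases Int.units_eq_one_or u with rfl | rfl <;> assumption

/-- Writing the sign vector as a literal leaves eight cases in which codes and coordinates reduce by
computation. -/
lemma forall_signs {p : (Fin 3 → ℤˣ) → Prop} (h : ∀ a b c, p ![a, b, c])
    (s : Fin 3 → ℤˣ) : p s := by
  have : s = ![s 0, s 1, s 2] := by ext i; fin_cases i <;> rfl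
  rw [this]; exact h _ _ _

lemma vertexOf_code (v : Vertex) : vertexOf v.code = v := by
  rcases v with ⟨k, u⟩ | ⟨k, s⟩ | ⟨k, s⟩
  · revert u; fin_cases k <;> exact forall_units rfl rfl
  all_goals
    revert s
    refine forall_signs fun a b c => ?_
    revert a b c
    fin_cases k <;> refine forall_units ?_ ?_ <;> refine forall_units ?_ ?_ <;>
      exact forall_units rfl rfl

lemma faceOf_code (f : Face) : faceOf f.code = f := by
  rcases f with ⟨k, a, c⟩ | ⟨k, t, a, c⟩ | ⟨k, a, c⟩ | ⟨k, a, c⟩ | ⟨k, t⟩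
  · revert a c; fin_cases k <;> refine forall_units ?_ ?_ <;> exact forall_units rfl rfl
  · revert t a c
    fin_cases k <;> refine forall_units ?_ ?_ <;> refine forall_units ?_ ?_ <;>
      exact forall_units rfl rfl
  · revert a c; fin_cases k <;> refine forall_units ?_ ?_ <;> exact forall_units rfl rfl
  · revert a c; fin_cases k <;> refine forall_units ?_ ?_ <;> exact forall_units rfl rfl
  · revert t; fin_cases k <;> exact forall_units rfl rfl

lemma code_vertexOf : ∀ n < 54, (vertexOf n).code = n := by decide +kernel

lemma code_faceOf : ∀ n < 66, (faceOf n).code = n := by decide +kernel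

lemma bit_le (u : ℤˣ) : bit u ≤ 1 := by unfold bit; split_ifs <;> omega

lemma Vertex.code_lt (v : Vertex) : v.code < 54 := by
  rcases v with ⟨k, u⟩ | ⟨k, s⟩ | ⟨k, s⟩
  · have := bit_le u; simp only [Vertex.code]; omega
  all_goals
    have := bit_le (s 0); have := bit_le (s 1); have := bit_le (s 2)
    simp only [Vertex.code]; omega

lemma Face.code_lt (f : Face) : f.code < 66 := by
  rcases f with ⟨k, a, c⟩ | ⟨k, t, a, c⟩ | ⟨k, a, c⟩ | ⟨k, a, c⟩ | ⟨k, t⟩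
  · have := bit_le a; have := bit_le c; simp only [Face.code]; omega
  · have := bit_le t; have := bit_le a; have := bit_le c; simp only [Face.code]; omega
  · have := bit_le a; have := bit_le c; simp only [Face.code]; omega
  · have := bit_le a; have := bit_le c; simp only [Face.code]; omega
  · have := bit_le t; simp only [Face.code]; omega

lemma Vertex.code_injective : Function.Injective Vertex.code :=
  Function.LeftInverse.injective vertexOf_code

lemma Face.code_injective : Function.Injective Face.code :=
  Function.LeftInverse.injective faceOf_code

/-- Vertices correspond to their numbers. -/
def vertexEquiv : Vertex ≃ Fin 54 where
  toFun v := ⟨v.code, v.code_lt⟩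
  invFun n := vertexOf n
  left_inv := vertexOf_code
  right_inv n := Fin.ext (code_vertexOf n n.2)

/-- Faces correspond to their numbers. -/
def faceEquiv : Face ≃ Fin 66 where
  toFun f := ⟨f.code, f.code_lt⟩
  invFun n := faceOf n
  left_inv := faceOf_code
  right_inv n := Fin.ext (code_faceOf n n.2)

/-- The only comparison of `cornerTable` with the defining `faceCorner`; the later incidence checks
speak of table entries alone. -/
lemma code_faceCorner_faceOf :
    ∀ n < 66, ∀ i : Fin 4, (faceCorner (faceOf n) i).code = cornerCode n i := by
  decide +kernel

lemma code_faceCorner (f : Face) (i : Fin 4) : (faceCorner f i).code = cornerCode f.code i := by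
  have := code_faceCorner_faceOf f.code f.code_lt i
  rwa [faceOf_code] at this

lemma cornerCode_mod (f i : ℕ) : cornerCode f (i % 4) = cornerCode f i := by
  simp [cornerCode]

lemma code_faceCorner_finRotate (f : Face) (i : Fin 4) :
    (faceCorner f (finRotate 4 i)).code = cornerCode f.code (i + 1) := by
  rw [code_faceCorner, finRotate_apply, Fin.val_add, cornerCode_mod]
  rfl

/-! ### Edges: two faces at each of them, 132 in all -/

/-- Whether the vertices number `u` and `v` are the ends of an edge of the face number `f`. -/
def hasEdge (f u v : ℕ) : Bool :=
  (List.range 4).any fun i =>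
    ((cornerCode f i).beq u && (cornerCode f (i + 1)).beq v) ||
    ((cornerCode f i).beq v && (cornerCode f (i + 1)).beq u)

lemma hasEdge_iff {f u v : ℕ} : hasEdge f u v = true ↔
    ∃ i < 4, (cornerCode f i = u ∧ cornerCode f (i + 1) = v) ∨
      (cornerCode f i = v ∧ cornerCode f (i + 1) = u) := by
  simp [hasEdge]

/-- The edges of a face, as pairs of vertices. -/
def edgesOf (f : Face) : Set (Sym2 Vertex) :=
  Set.range fun i : Fin 4 => s(faceCorner f i, faceCorner f (finRotate 4 i))

/-- All edges of the polyhedron. -/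
def allEdges : Set (Sym2 Vertex) := ⋃ f, edgesOf f

lemma mem_faceEdges {f : Face} {v w : Vertex} :
    s(v, w) ∈ edgesOf f ↔ hasEdge f.code v.code w.code = true := by
  have hc : ∀ (i : Fin 4) (v : Vertex), faceCorner f i = v ↔ cornerCode f.code i = v.code := by
    intro i v
    rw [← code_faceCorner, Vertex.code_injective.eq_iff]
  have hr : ∀ (i : Fin 4) (v : Vertex), faceCorner f (finRotate 4 i) = v ↔
      cornerCode f.code (i + 1) = v.code := by
    intro i v
    rw [← code_faceCorner_finRotate, Vertex.code_injective.eq_iff]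
  rw [hasEdge_iff]
  constructor
  · rintro ⟨i, hi⟩
    change s(faceCorner f i, faceCorner f (finRotate 4 i)) = s(v, w) at hi
    rw [Sym2.eq_iff, hr, hr, hc, hc] at hi
    exact ⟨i, i.2, hi⟩
  · rintro ⟨i, hi, h⟩
    refine ⟨(⟨i, hi⟩ : Fin 4), ?_⟩
    change s(faceCorner f ⟨i, hi⟩, faceCorner f (finRotate 4 ⟨i, hi⟩)) = s(v, w)
    rw [Sym2.eq_iff, hr, hr, hc, hc]
    exact h

lemma length_faces_of_edge : ((List.range 66).all fun f => (List.range 4).all fun i =>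
    ((List.range 66).filter fun g =>
      hasEdge g (cornerCode f i) (cornerCode f (i + 1))).length.beq 2) = true := by
  decide +kernel

lemma card_faces_of_edge {f i : ℕ} (hf : f < 66) (hi : i < 4) :
    ((Finset.range 66).filter fun g =>
      hasEdge g (cornerCode f i) (cornerCode f (i + 1)) = true).card = 2 := by
  have h := length_faces_of_edge
  simp only [List.all_eq_true, List.mem_range] at h
  rw [← Nat.eq_of_beq_eq_true (h f hf i hi)]
  change (List.filter _ _).length = _
  simp

lemma mem_edges {v w : Vertex} :
    s(v, w) ∈ allEdges ↔ ∃ f < 66, hasEdge f v.code w.code = true := by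
  rw [allEdges, Set.mem_iUnion]
  constructor
  · rintro ⟨f, hf⟩
    exact ⟨f.code, f.code_lt, mem_faceEdges.1 hf⟩
  · rintro ⟨f, hf, h⟩
    exact ⟨faceOf f, mem_faceEdges.2 (by rwa [code_faceOf f hf])⟩

lemma two_faces (e : Sym2 Vertex) (he : e ∈ allEdges) :
    {f | e ∈ edgesOf f}.ncard = 2 := by
  induction e with | _ v w
  obtain ⟨f, hf, h⟩ := mem_edges.1 he
  obtain ⟨i, hi, h⟩ := hasEdge_iff.1 h
  have key : ∀ v w : Vertex, cornerCode f i = v.code → cornerCode f (i + 1) = w.code →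
      {f | s(v, w) ∈ edgesOf f}.ncard = 2 := by
    intro v w hv hw
    rw [← Set.ncard_image_of_injective _ Face.code_injective,
      ← card_faces_of_edge hf hi, ← Set.ncard_coe_finset]
    congr 1
    ext n
    simp only [Set.mem_image, Set.mem_ofPred_eq, Finset.coe_filter, Finset.mem_range]
    constructor
    · rintro ⟨g, hg, rfl⟩
      exact ⟨g.code_lt, hv ▸ hw ▸ mem_faceEdges.1 hg⟩
    · rintro ⟨hn, hg⟩
      refine ⟨faceOf n, mem_faceEdges.2 ?_, code_faceOf n hn⟩
      rwa [code_faceOf n hn, ← hv, ← hw]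
  rcases h with h | h
  · exact key v w h.1 h.2
  · rw [Sym2.eq_swap]
    exact key w v h.1 h.2

/-- A number that encodes an unordered pair of numbers below 64. -/
def pairCode (u v : ℕ) : ℕ := 64 * min u v + max u v

lemma pairCode_inj {u v u' v' : ℕ} (hu : u < 64) (hv : v < 64) (hu' : u' < 64) (hv' : v' < 64)
    (h : pairCode u v = pairCode u' v') : (u = u' ∧ v = v') ∨ (u = v' ∧ v = u') := by
  unfold pairCode at h; omega

/-- The number of an edge. -/
def edgeCode : Sym2 Vertex → ℕ :=
  Sym2.lift ⟨fun v w => pairCode v.code w.code, fun v w => by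
    simp [pairCode, min_comm, max_comm]⟩

lemma edgeCode_injective : Function.Injective edgeCode := by
  intro e e' h
  induction e with | _ v w
  induction e' with | _ v' w'
  have hl : ∀ v : Vertex, v.code < 64 := fun v => v.code_lt.trans (by norm_num)
  rw [Sym2.eq_iff]
  exact (pairCode_inj (hl _) (hl _) (hl _) (hl _) h).imp
    (And.imp (@Vertex.code_injective _ _) (@Vertex.code_injective _ _))
    (And.imp (@Vertex.code_injective _ _) (@Vertex.code_injective _ _))

/-- The numbers of the edges. -/
def edgeCodes : Finset ℕ := ((Finset.range 66) ×ˢ (Finset.range 4)).image fun p =>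
  pairCode (cornerCode p.1 p.2) (cornerCode p.1 (p.2 + 1))

lemma card_edgeCodes : edgeCodes.card = 132 := by decide +kernel

lemma mem_edgeCodes {n : ℕ} : n ∈ edgeCodes ↔
    ∃ f i, (f < 66 ∧ i < 4) ∧ pairCode (cornerCode f i) (cornerCode f (i + 1)) = n := by
  simp only [edgeCodes, Finset.mem_image, Finset.mem_product, Finset.mem_range, Prod.exists]

lemma ncard_edges : allEdges.ncard = 132 := by
  rw [← Set.ncard_image_of_injective _ edgeCode_injective,
    ← card_edgeCodes, ← Set.ncard_coe_finset]
  refine congrArg Set.ncard (Set.ext fun e => ?_)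
  rw [Set.mem_image, Finset.mem_coe, mem_edgeCodes]
  constructor
  · rintro ⟨e, he, rfl⟩
    obtain ⟨f, i, rfl⟩ := Set.mem_iUnion.1 he
    refine ⟨f.code, i, ⟨f.code_lt, i.2⟩, ?_⟩
    exact congrArg₂ pairCode (code_faceCorner f i).symm (code_faceCorner_finRotate f i).symm
  · rintro ⟨f, i, ⟨hf, hi⟩, rfl⟩
    refine ⟨s(faceCorner (faceOf f) ⟨i, hi⟩, faceCorner (faceOf f) (finRotate 4 ⟨i, hi⟩)),
      Set.mem_iUnion.2 ⟨faceOf f, ⟨i, hi⟩, rfl⟩, ?_⟩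
    change pairCode _ _ = _
    rw [code_faceCorner, code_faceCorner_finRotate, code_faceOf f hf]

/-! ### Finite checks on the vertex stars and corners -/

lemma three_le_length_star : ∀ v < 54, 3 ≤ (star v).length := by decide +kernel

lemma nodup_star : ∀ v < 54, (star v).Nodup := by decide +kernel

lemma star_lt : ∀ v < 54, ∀ w ∈ star v, w < 54 := by decide +kernel

lemma corner_mem_star : ∀ f < 66, ∀ i < 4, cornerCode f (i + 1) ∈ star (cornerCode f i) ∧
    cornerCode f i ∈ star (cornerCode f (i + 1)) := by
  decide +kernel

lemma any_face_star : ((List.range 54).all fun v => (List.range (star v).length).all fun i =>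
    (List.range 66).any fun f => hasEdge f v ((star v).getD i 0) &&
      hasEdge f v ((star v).getD (cyc (star v).length i) 0)) = true := by
  decide +kernel

lemma exists_face_star {v i : ℕ} (hv : v < 54) (hi : i < (star v).length) : ∃ f < 66,
    hasEdge f v ((star v).getD i 0) = true ∧
      hasEdge f v ((star v).getD (cyc (star v).length i) 0) = true := by
  have h := any_face_star
  simp only [List.all_eq_true, List.any_eq_true, List.mem_range, Bool.and_eq_true] at h
  exact h v hv i hi

/-- Two edges of one face at a vertex lead to the corners `j + 1` and `j + 3` (that is, `j - 1`
modulo 4). Their being neighbours in the star shows that the link has no edges beyond those of the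
cycle; `exists_face_star` supplies these. -/
lemma consecutive_star : ∀ f < 66, ∀ j < 4, ∃ i < (star (cornerCode f j)).length,
    ((star (cornerCode f j)).getD i 0 = cornerCode f (j + 1) ∧
      (star (cornerCode f j)).getD (cyc (star (cornerCode f j)).length i) 0 =
        cornerCode f (j + 3)) ∨
    ((star (cornerCode f j)).getD i 0 = cornerCode f (j + 3) ∧
      (star (cornerCode f j)).getD (cyc (star (cornerCode f j)).length i) 0 =
        cornerCode f (j + 1)) := by
  decide +kernel

lemma cornerCode_ne : ∀ f < 66, ∀ i < 4, ∀ j < i, cornerCode f i ≠ cornerCode f j := by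
  decide +kernel

/-! ### The geometry of the polyhedron

Twice the coordinates of the vertices are integral linear functions of `B = L / √2`. A linear
inequality between vertices that holds for `B = 2` and for `B = 3` holds for `B = 3 / √2`. -/

/-- The sign that is encoded by the last bit of a number. -/
def bitSign (n : ℕ) : ℤ := if n % 2 = 0 then 1 else -1

/-- Twice the coordinate `m` of the vertex with the number `v`, when the apexes have distance `B`
from the origin, is `(coordInt v m).1 + (coordInt v m).2 * B`. -/
def coordInt (v m : ℕ) : ℤ × ℤ :=
  if v < 6 then (0, if m = v / 2 then 2 * bitSign v else 0)
  else if m = (v - 6) / 8 % 3 then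
    (if v < 30 then bitSign ((v - 6) / 2 ^ (2 - m)) else 3 * bitSign ((v - 6) / 2 ^ (2 - m)),
      2 * bitSign ((v - 6) / 2 ^ (2 - m)))
  else (bitSign ((v - 6) / 2 ^ (2 - m)), 0)

/-- The distance of the apexes from the origin. -/
noncomputable def apexDist : ℝ := 3 / √2

lemma apexDist_pos : 0 < apexDist := by unfold apexDist; positivity

lemma apexDist_sq : apexDist ^ 2 = 9 / 2 := by
  rw [apexDist, div_pow, Real.sq_sqrt (by norm_num)]; norm_num

lemma two_lt_apexDist : 2 < apexDist := by nlinarith [apexDist_sq, apexDist_pos]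

lemma apexDist_lt_three : apexDist < 3 := by nlinarith [apexDist_sq, apexDist_pos]

lemma vertexPos_apply (v : Vertex) (m : Fin 3) : vertexPos 3 v m =
    ((coordInt v.code m).1 + (coordInt v.code m).2 * apexDist) / 2 := by
  rcases v with ⟨k, u⟩ | ⟨k, s⟩ | ⟨k, s⟩
  · revert u
    fin_cases k <;> refine forall_units ?_ ?_ <;> fin_cases m <;>
      simp [vertexPos, Vertex.code, coordInt, bit, bitSign, apexDist] <;> ring
  all_goals
    revert s
    refine forall_signs fun a b c => ?_
    revert a b c
    fin_cases k <;> refine forall_units ?_ ?_ <;> refine forall_units ?_ ?_ <;>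
      refine forall_units ?_ ?_ <;> fin_cases m <;>
      simp [vertexPos, Vertex.code, coordInt, bit, bitSign, apexDist] <;> ring

/-- The inner product of the vectors `b a` and `d c` between numbered vertices is
`(gramInt a b c d).1 / 8 + (gramInt a b c d).2 * B / 4`, where `B = 3 / √2`. -/
def gramInt (a b c d : ℕ) : ℤ × ℤ :=
  let x (m : ℕ) := (coordInt a m).1 - (coordInt b m).1
  let y (m : ℕ) := (coordInt a m).2 - (coordInt b m).2
  let x' (m : ℕ) := (coordInt c m).1 - (coordInt d m).1
  let y' (m : ℕ) := (coordInt c m).2 - (coordInt d m).2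
  (2 * (x 0 * x' 0 + x 1 * x' 1 + x 2 * x' 2) + 9 * (y 0 * y' 0 + y 1 * y' 1 + y 2 * y' 2),
    x 0 * y' 0 + y 0 * x' 0 + (x 1 * y' 1 + y 1 * x' 1) + (x 2 * y' 2 + y 2 * x' 2))

lemma inner_vertexPos (a b c d : Vertex) :
    inner ℝ (vertexPos 3 a - vertexPos 3 b) (vertexPos 3 c - vertexPos 3 d) =
      ((gramInt a.code b.code c.code d.code).1 : ℝ) / 8 +
        (gramInt a.code b.code c.code d.code).2 * apexDist / 4 := by
  rw [EuclideanSpace.inner_eq_star_dotProduct]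
  simp only [dotProduct, Fin.sum_univ_three, WithLp.ofLp_sub, Pi.sub_apply, Pi.star_apply,
    star_trivial, vertexPos_apply, gramInt]
  push_cast
  simp only [Fin.val_zero, Fin.val_one, Fin.val_two]
  -- Only the coefficient of B² has to be corrected, by B² = 9/2.
  linear_combination
    ((((coordInt a.code 0).2 : ℝ) - (coordInt b.code 0).2) *
        ((coordInt c.code 0).2 - (coordInt d.code 0).2) +
      (((coordInt a.code 1).2 : ℝ) - (coordInt b.code 1).2) *
        ((coordInt c.code 1).2 - (coordInt d.code 1).2) +
      (((coordInt a.code 2).2 : ℝ) - (coordInt b.code 2).2) *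
        ((coordInt c.code 2).2 - (coordInt d.code 2).2)) / 4 * apexDist_sq

/-- The corners of a face in space. -/
noncomputable def facePos (f : Face) (i : Fin 4) : E3 := vertexPos 3 (faceCorner f i)

lemma val_three : ((3 : Fin 4) : ℕ) = 3 := rfl

/-- The vanishing second components say that B drops out of the squared side lengths, which can
therefore be compared with the net as integers. -/
lemma gramInt_face : ∀ f < 66,
    gramInt (cornerCode f 1) (cornerCode f 0) (cornerCode f 3) (cornerCode f 0) = (0, 0) ∧
    0 < (gramInt (cornerCode f 1) (cornerCode f 0) (cornerCode f 1) (cornerCode f 0)).1 ∧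
    (gramInt (cornerCode f 1) (cornerCode f 0) (cornerCode f 1) (cornerCode f 0)).2 = 0 ∧
    0 < (gramInt (cornerCode f 3) (cornerCode f 0) (cornerCode f 3) (cornerCode f 0)).1 ∧
    (gramInt (cornerCode f 3) (cornerCode f 0) (cornerCode f 3) (cornerCode f 0)).2 = 0 := by
  decide +kernel

lemma coordInt_face : ∀ f < 66, ∀ m < 3,
    coordInt (cornerCode f 2) m - coordInt (cornerCode f 1) m =
      coordInt (cornerCode f 3) m - coordInt (cornerCode f 0) m := by
  decide +kernel

lemma inner_facePos (f : Face) (i j k l : Fin 4) :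
    inner ℝ (facePos f i - facePos f j) (facePos f k - facePos f l) =
      ((gramInt (cornerCode f.code i) (cornerCode f.code j) (cornerCode f.code k)
        (cornerCode f.code l)).1 : ℝ) / 8 +
      (gramInt (cornerCode f.code i) (cornerCode f.code j) (cornerCode f.code k)
        (cornerCode f.code l)).2 * apexDist / 4 := by
  simp only [facePos, inner_vertexPos, code_faceCorner]

lemma facePos_perp (f : Face) :
    inner ℝ (facePos f 1 - facePos f 0) (facePos f 3 - facePos f 0) = 0 := by
  rw [inner_facePos]
  have := (gramInt_face f.code f.code_lt).1
  simp only [Fin.val_zero, Fin.val_one, val_three] at *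
  simp [this]

lemma normSq_facePos_one (f : Face) : ‖facePos f 1 - facePos f 0‖ ^ 2 =
    ((gramInt (cornerCode f.code 1) (cornerCode f.code 0) (cornerCode f.code 1)
      (cornerCode f.code 0)).1 : ℝ) / 8 := by
  rw [← real_inner_self_eq_norm_sq, inner_facePos]
  have := (gramInt_face f.code f.code_lt).2.2.1
  simp only [Fin.val_zero, Fin.val_one] at *
  simp [this]

lemma normSq_facePos_three (f : Face) : ‖facePos f 3 - facePos f 0‖ ^ 2 =
    ((gramInt (cornerCode f.code 3) (cornerCode f.code 0) (cornerCode f.code 3)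
      (cornerCode f.code 0)).1 : ℝ) / 8 := by
  rw [← real_inner_self_eq_norm_sq, inner_facePos]
  have := (gramInt_face f.code f.code_lt).2.2.2.2
  simp only [Fin.val_zero, val_three] at *
  simp [this]

lemma norm_facePos_one_ne (f : Face) : ‖facePos f 1 - facePos f 0‖ ≠ 0 := by
  intro h
  have h1 := normSq_facePos_one f
  have h2 : (0 : ℝ) < _ := Int.cast_pos.2 (gramInt_face f.code f.code_lt).2.1
  rw [h] at h1
  linarith

lemma norm_facePos_three_ne (f : Face) : ‖facePos f 3 - facePos f 0‖ ≠ 0 := by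
  intro h
  have h1 := normSq_facePos_three f
  have h2 : (0 : ℝ) < _ := Int.cast_pos.2 (gramInt_face f.code f.code_lt).2.2.2.1
  rw [h] at h1
  linarith

lemma facePos_parallelogram (f : Face) :
    facePos f 2 - facePos f 1 = facePos f 3 - facePos f 0 := by
  ext m
  have h := coordInt_face f.code f.code_lt m m.2
  have h1 := congrArg (fun p : ℤ × ℤ => (p.1 : ℝ)) h
  have h2 := congrArg (fun p : ℤ × ℤ => (p.2 : ℝ)) h
  simp only [Prod.fst_sub, Prod.snd_sub] at h1 h2
  push_cast at h1 h2
  simp only [facePos, PiLp.sub_apply, vertexPos_apply, code_faceCorner]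
  simp only [Fin.val_zero, Fin.val_one, Fin.val_two, val_three]
  linear_combination h1 / 2 + apexDist / 2 * h2

/-- The rectangle covered by a face. -/
noncomputable def faceRegion (f : Face) : Set E3 := convexHull ℝ (Set.range (facePos f))

lemma isPlanarPolygon_face (f : Face) : IsPlanarPolygon ⟨facePos f⟩ (faceRegion f) :=
  isPlanarPolygon_rect _ (facePos_parallelogram f)
    (fun h => norm_facePos_one_ne f (by rw [h, sub_self, norm_zero]))
    (fun h => norm_facePos_three_ne f (by rw [h, sub_self, norm_zero])) (facePos_perp f)

/-! ### Separation of faces -/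

/-- Twice the value of the linear functional with the coefficients `q` at a numbered vertex, when
the apexes have distance `B` from the origin. -/
def evalInt (q : ℤ × ℤ × ℤ) (B : ℤ) (v : ℕ) : ℤ :=
  q.1 * ((coordInt v 0).1 + (coordInt v 0).2 * B) +
    q.2.1 * ((coordInt v 1).1 + (coordInt v 1).2 * B) +
    q.2.2 * ((coordInt v 2).1 + (coordInt v 2).2 * B)

/-- The linear functional with the coefficients `q`. -/
noncomputable def functional (q : ℤ × ℤ × ℤ) : E3 →ₗ[ℝ] ℝ where
  toFun p := q.1 * p 0 + q.2.1 * p 1 + q.2.2 * p 2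
  map_add' p p' := by simp; ring
  map_smul' c p := by simp; ring

/-- An affine function of B is the interpolation of its values at 2 and 3, with the weights `3 - B`
and `B - 2`; both are positive here. -/
lemma functional_vertexPos (q : ℤ × ℤ × ℤ) (v : Vertex) : functional q (vertexPos 3 v) =
    ((3 - apexDist) * evalInt q 2 v.code + (apexDist - 2) * evalInt q 3 v.code) / 2 := by
  simp only [functional, LinearMap.coe_mk, AddHom.coe_mk, vertexPos_apply, evalInt]
  push_cast
  simp only [Fin.val_zero, Fin.val_one, Fin.val_two]
  ring

lemma functional_le {q : ℤ × ℤ × ℤ} {v w : Vertex} (h2 : evalInt q 2 v.code ≤ evalInt q 2 w.code)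
    (h3 : evalInt q 3 v.code ≤ evalInt q 3 w.code) :
    functional q (vertexPos 3 v) ≤ functional q (vertexPos 3 w) := by
  rw [functional_vertexPos, functional_vertexPos]
  have h2 : (evalInt q 2 v.code : ℝ) ≤ evalInt q 2 w.code := by exact_mod_cast h2
  have h3 : (evalInt q 3 v.code : ℝ) ≤ evalInt q 3 w.code := by exact_mod_cast h3
  nlinarith [mul_le_mul_of_nonneg_left h2 (sub_nonneg.2 apexDist_lt_three.le),
    mul_le_mul_of_nonneg_left h3 (sub_nonneg.2 two_lt_apexDist.le)]

lemma functional_lt {q : ℤ × ℤ × ℤ} {v w : Vertex} (h2 : evalInt q 2 v.code < evalInt q 2 w.code)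
    (h3 : evalInt q 3 v.code < evalInt q 3 w.code) :
    functional q (vertexPos 3 v) < functional q (vertexPos 3 w) := by
  rw [functional_vertexPos, functional_vertexPos]
  have h2 : (evalInt q 2 v.code : ℝ) < evalInt q 2 w.code := by exact_mod_cast h2
  have h3 : (evalInt q 3 v.code : ℝ) < evalInt q 3 w.code := by exact_mod_cast h3
  nlinarith [mul_lt_mul_of_pos_left h2 (sub_pos.2 apexDist_lt_three),
    mul_lt_mul_of_pos_left h3 (sub_pos.2 two_lt_apexDist)]

/-- Where a linear functional attains its least value on the hull of some points, the hull is
spanned by the points at which this happens. -/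
lemma mem_convexHull_of_functional {ι : Type*} {P : ι → E3} {ℓ : E3 →ₗ[ℝ] ℝ} {c : ℝ}
    (h : ∀ i, c ≤ ℓ (P i)) {x : E3} (hx : x ∈ convexHull ℝ (Set.range P)) (hc : ℓ x ≤ c) :
    x ∈ convexHull ℝ (P '' {i | ℓ (P i) = c}) := by
  set H := convexHull ℝ (P '' {i | ℓ (P i) = c})
  have hH : ∀ y ∈ H, ℓ y = c := fun y hy => by
    have : H ⊆ {y | ℓ y = c} := by
      refine convexHull_min ?_ ?_
      · rintro _ ⟨i, hi, rfl⟩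
        exact hi
      · intro y hy z hz a b _ _ hab
        change ℓ (a • y + b • z) = c
        rw [map_add, map_smul, map_smul, show ℓ y = c from hy, show ℓ z = c from hz, ← add_smul,
          hab, one_smul]
    exact this hy
  -- A proper mixture with a point of value greater than `c` has value greater than `c`, so this
  -- union is convex. It contains all the points, hence their hull, and `x` can only be in the part
  -- `H`.
  have hK : Convex ℝ (H ∪ {y | c < ℓ y}) := by
    intro y hy z hz a b ha hb hab
    have hle : ∀ y ∈ H ∪ {y | c < ℓ y}, c ≤ ℓ y := by
      rintro y (hy | hy)
      · exact (hH y hy).ge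
      · exact le_of_lt hy
    have hval : ℓ (a • y + b • z) - c = a * (ℓ y - c) + b * (ℓ z - c) := by
      rw [map_add, map_smul, map_smul, smul_eq_mul, smul_eq_mul]
      linear_combination c * hab
    have hy' := sub_nonneg.2 (hle y hy)
    have hz' := sub_nonneg.2 (hle z hz)
    rcases ha.eq_or_lt with rfl | ha'
    · obtain rfl : b = 1 := by linarith
      simpa using hz
    rcases hb.eq_or_lt with rfl | hb'
    · obtain rfl : a = 1 := by linarith
      simpa using hy
    rcases hy with hy | hy
    · rcases hz with hz | hz
      · exact Or.inl (convex_convexHull ℝ _ hy hz ha hb hab)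
      · refine Or.inr (show c < _ from sub_pos.1 ?_)
        rw [hval]
        exact add_pos_of_nonneg_of_pos (mul_nonneg ha hy') (mul_pos hb' (sub_pos.2 hz))
    · refine Or.inr (show c < _ from sub_pos.1 ?_)
      rw [hval]
      exact add_pos_of_pos_of_nonneg (mul_pos ha' (sub_pos.2 hy)) (mul_nonneg hb hz')
  have hsub : convexHull ℝ (Set.range P) ⊆ H ∪ {y | c < ℓ y} := by
    refine convexHull_min ?_ hK
    rintro _ ⟨i, rfl⟩
    rcases (h i).eq_or_lt with h' | h'
    · exact Or.inl (subset_convexHull ℝ _ ⟨i, h'.symm, rfl⟩)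
    · exact Or.inr h'
  rcases hsub hx with h' | h'
  · exact h'
  · exact absurd hc (not_le.2 h')

/-- Whether the corner `i` of the face number `f` is a corner of the face number `g`. -/
def isCommon (f g i : ℕ) : Bool := (List.range 4).any fun j => (cornerCode g j).beq (cornerCode f i)

/-- Whether the functional `q` separates the face number `f` from the face number `g`, strictly
except at common corners. -/
def separates (q : ℤ × ℤ × ℤ) (f g : ℕ) : Bool :=
  (List.range 4).all fun i => (List.range 4).all fun j =>
    (decide (evalInt q 2 (cornerCode g j) < evalInt q 2 (cornerCode f i)) &&
      decide (evalInt q 3 (cornerCode g j) < evalInt q 3 (cornerCode f i))) ||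
    (isCommon f g i && decide (evalInt q 2 (cornerCode g j) ≤ evalInt q 2 (cornerCode f i)) &&
      decide (evalInt q 3 (cornerCode g j) ≤ evalInt q 3 (cornerCode f i)))

/-- Functionals that suffice to separate any two faces. -/
def functionals : List (ℤ × ℤ × ℤ) :=
  [(0, -1, -2), (0, 1, 2), (-2, 1, 0), (2, -1, 1), (-1, -2, 1), (1, 2, -2), (2, 1, 0),
    (-2, -1, -1), (1, -2, -1), (-1, 2, 1), (-1, 0, 1), (1, 0, -1), (-1, 1, -2), (1, 0, 2),
    (0, -1, 0), (1, 2, -1), (-1, 0, 0), (0, 0, -1), (0, -1, 1), (0, 1, -1), (1, 0, 0), (1, 1, 1),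
    (-2, 1, -1), (1, 1, 0), (1, -1, -1), (-1, -1, -1), (-1, -1, 1), (-1, 1, 1), (1, -1, 1),
    (0, 1, 1), (1, 0, 1), (-1, 1, 0), (1, -1, 0), (0, -1, -1), (-1, -1, 0), (1, 1, -1),
    (-1, 1, -1)]

/-- The certificate for the absence of self-intersections: 37 functionals suffice for all pairs of
faces. -/
lemma all_separates : ((List.range 66).all fun f => (List.range f).all fun g =>
    functionals.any fun q => separates q f g) = true := by
  decide +kernel

/-- Let `c` be the maximum of the separating functional on `g`. On `f` it is at least `c`, so a
common point lies where `f` attains the value `c`; the corners of `f` with that value are common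
corners. -/
lemma faceRegion_inter_subset_of_lt {f g : Face} (h : g.code < f.code) :
    faceRegion f ∩ faceRegion g ⊆
      convexHull ℝ (facePos f '' {i | ∃ j, faceCorner g j = faceCorner f i}) := by
  rintro x ⟨hf, hg⟩
  have key := all_separates
  simp only [List.all_eq_true, List.any_eq_true, List.mem_range] at key
  obtain ⟨q, -, hq⟩ := key f.code f.code_lt g.code h
  simp only [separates, isCommon, List.all_eq_true, List.any_eq_true, List.mem_range,
    Bool.or_eq_true, Bool.and_eq_true, decide_eq_true_eq, Nat.beq_eq] at hq
  have hq' : ∀ i j : Fin 4,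
      functional q (facePos g j) < functional q (facePos f i) ∨
      ((∃ j, faceCorner g j = faceCorner f i) ∧
        functional q (facePos g j) ≤ functional q (facePos f i)) := by
    intro i j
    have h' := hq i i.2 j j.2
    simp only [← code_faceCorner] at h'
    rcases h' with ⟨h2, h3⟩ | ⟨⟨⟨l, hl, hl'⟩, h2⟩, h3⟩
    · exact Or.inl (functional_lt h2 h3)
    · refine Or.inr ⟨⟨⟨l, hl⟩, Vertex.code_injective ?_⟩, functional_le h2 h3⟩
      rw [← hl', code_faceCorner]
  obtain ⟨l, hl⟩ := Finite.exists_max fun j => functional q (facePos g j)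
  have hx : functional q x ≤ functional q (facePos g l) := by
    have : faceRegion g ⊆ {y | functional q y ≤ functional q (facePos g l)} := by
      refine convexHull_min ?_ (convex_halfSpace_le (functional q).isLinear _)
      rintro _ ⟨j, rfl⟩
      exact hl j
    exact this hg
  refine convexHull_mono (Set.image_mono ?_) (mem_convexHull_of_functional (P := facePos f)
    (ℓ := functional q) (c := functional q (facePos g l)) (fun i => ?_) hf hx)
  · intro i hi
    rcases hq' i l with h' | h'
    · exact absurd hi h'.ne'
    · exact h'.1
  · rcases hq' i l with h' | h'
    · exact h'.le
    · exact h'.2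

lemma faceRegion_inter_subset {f g : Face} (h : f ≠ g) :
    faceRegion f ∩ faceRegion g ⊆
      convexHull ℝ (facePos f '' {i | ∃ j, faceCorner g j = faceCorner f i}) := by
  rcases lt_or_gt_of_ne (Face.code_injective.ne h) with h' | h'
  · rw [Set.inter_comm]
    refine (faceRegion_inter_subset_of_lt h').trans (convexHull_mono ?_)
    rintro _ ⟨i, ⟨j, hj⟩, rfl⟩
    exact ⟨j, ⟨i, hj.symm⟩, congrArg (vertexPos 3) hj⟩
  · exact faceRegion_inter_subset_of_lt h'

/-- The ways in which the faces number `f` and `g` may have common corners. -/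
def meetsWell (f g : ℕ) : Bool :=
  ((List.range 4).all fun i => !isCommon f g i) ||
  ((List.range 4).any fun i => isCommon f g i &&
    (List.range 4).all fun l => l.beq i || !isCommon f g l) ||
  ((List.range 4).any fun i => hasEdge g (cornerCode f i) (cornerCode f (i + 1)) &&
    (List.range 4).all fun l => l.beq i || l.beq ((i + 1) % 4) || !isCommon f g l)

/-- The common corners are none, a single one, or the two ends of a common edge, so their hull is
empty, a vertex or an edge. -/
lemma all_meetsWell : ((List.range 66).all fun f => (List.range 66).all fun g =>
    f.beq g || meetsWell f g) = true := by
  decide +kernel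

lemma isCommon_iff {f g : Face} {i : Fin 4} :
    isCommon f.code g.code i = true ↔ ∃ j, faceCorner g j = faceCorner f i := by
  simp only [isCommon, List.any_eq_true, List.mem_range, Nat.beq_eq,
    ← Vertex.code_injective.eq_iff, code_faceCorner]
  exact ⟨fun ⟨j, hj, h⟩ => ⟨⟨j, hj⟩, h⟩, fun ⟨j, h⟩ => ⟨j, j.2, h⟩⟩

lemma fin4_finRotate_val (i : Fin 4) : (finRotate 4 i : ℕ) = (i + 1) % 4 := by
  rw [finRotate_apply, Fin.val_add]; rfl

lemma facePos_mem (f : Face) (i : Fin 4) : facePos f i ∈ faceRegion f :=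
  subset_convexHull ℝ _ ⟨i, rfl⟩

/-- Two faces are disjoint, share a corner, or share an edge. -/
lemma faceRegion_inter {f g : Face} (h : f ≠ g) :
    Disjoint (faceRegion f) (faceRegion g) ∨
    (∃ i j, faceCorner f i = faceCorner g j ∧ faceRegion f ∩ faceRegion g = {facePos f i}) ∨
    (∃ i j, ((faceCorner f i = faceCorner g j ∧
          faceCorner f (finRotate 4 i) = faceCorner g (finRotate 4 j)) ∨
        (faceCorner f i = faceCorner g (finRotate 4 j) ∧
          faceCorner f (finRotate 4 i) = faceCorner g j)) ∧
      faceRegion f ∩ faceRegion g = segment ℝ (facePos f i) (facePos f (finRotate 4 i))) := by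
  have hsub := faceRegion_inter_subset h
  have key := all_meetsWell
  simp only [List.all_eq_true, List.mem_range, Bool.or_eq_true, Nat.beq_eq] at key
  have hk := (key f.code f.code_lt g.code g.code_lt).resolve_left (Face.code_injective.ne h)
  simp only [meetsWell, Bool.or_eq_true, List.all_eq_true, List.any_eq_true, List.mem_range,
    Bool.and_eq_true, Bool.not_eq_true', Nat.beq_eq] at hk
  have hn : ∀ i : Fin 4, isCommon f.code g.code i = false →
      ¬ ∃ j, faceCorner g j = faceCorner f i := by
    intro i hi h'
    rw [← isCommon_iff, hi] at h'
    exact Bool.noConfusion h'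
  rcases hk with (hk | ⟨i, hi, hc, hk⟩) | ⟨i, hi, he, hk⟩
  · left
    rw [Set.disjoint_iff]
    refine hsub.trans ?_
    have : {i | ∃ j, faceCorner g j = faceCorner f i} = ∅ :=
      Set.eq_empty_of_forall_notMem fun i => hn i (hk i i.2)
    rw [this]
    simp
  · right; left
    obtain ⟨j, hj⟩ := isCommon_iff (i := ⟨i, hi⟩).1 hc
    refine ⟨⟨i, hi⟩, j, hj.symm, Set.Subset.antisymm (hsub.trans ?_) ?_⟩
    · rw [← convexHull_singleton (𝕜 := ℝ) (facePos f ⟨i, hi⟩)]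
      refine convexHull_mono ?_
      rintro _ ⟨l, hl, rfl⟩
      rcases hk l l.2 with h' | h'
      · exact congrArg (facePos f) (Fin.ext h')
      · exact absurd hl (hn l h')
    · rintro _ rfl
      refine ⟨facePos_mem f _, ?_⟩
      rw [facePos, ← hj]
      exact facePos_mem g j
  · right; right
    obtain ⟨j, hj, he⟩ := hasEdge_iff.1 he
    have hr := code_faceCorner_finRotate f ⟨i, hi⟩
    have hr' := code_faceCorner_finRotate g ⟨j, hj⟩
    have hs := code_faceCorner f ⟨i, hi⟩
    have hs' := code_faceCorner g ⟨j, hj⟩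
    have he' : (faceCorner f ⟨i, hi⟩ = faceCorner g ⟨j, hj⟩ ∧
          faceCorner f (finRotate 4 ⟨i, hi⟩) = faceCorner g (finRotate 4 ⟨j, hj⟩)) ∨
        (faceCorner f ⟨i, hi⟩ = faceCorner g (finRotate 4 ⟨j, hj⟩) ∧
          faceCorner f (finRotate 4 ⟨i, hi⟩) = faceCorner g ⟨j, hj⟩) := by
      simp only [← Vertex.code_injective.eq_iff, hr, hr', hs, hs']
      rcases he with he | he
      · exact Or.inl ⟨he.1.symm, he.2.symm⟩
      · exact Or.inr ⟨he.2.symm, he.1.symm⟩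
    refine ⟨⟨i, hi⟩, ⟨j, hj⟩, he', Set.Subset.antisymm (hsub.trans ?_) ?_⟩
    · rw [← convexHull_pair]
      refine convexHull_mono ?_
      rintro _ ⟨l, hl, rfl⟩
      rcases hk l l.2 with (h' | h') | h'
      · exact Or.inl (congrArg (facePos f) (Fin.ext h'))
      · refine Or.inr (congrArg (facePos f) (Fin.ext ?_))
        rw [h', fin4_finRotate_val]
      · exact absurd hl (hn l h')
    · refine Set.subset_inter ((convex_convexHull ℝ _).segment_subset (facePos_mem f _)
        (facePos_mem f _)) ((convex_convexHull ℝ _).segment_subset ?_ ?_)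
      · rcases he' with he' | he' <;> rw [facePos, he'.1] <;> exact facePos_mem g _
      · rcases he' with he' | he' <;> rw [facePos, he'.2] <;> exact facePos_mem g _

/-- The six functionals are the signed coordinates: two vertices differ in some coordinate, in the
same direction for B = 2 and B = 3. -/
lemma exists_coord_lt : ∀ v < 54, ∀ w < v, ∃ q ∈ [((1 : ℤ), (0 : ℤ), (0 : ℤ)), (0, 1, 0), (0, 0, 1),
    (-1, 0, 0), (0, -1, 0), (0, 0, -1)],
    evalInt q 2 v < evalInt q 2 w ∧ evalInt q 3 v < evalInt q 3 w := by
  decide +kernel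

lemma vertexPos_injective : Function.Injective (vertexPos 3) := by
  have key : ∀ v w : Vertex, w.code < v.code → vertexPos 3 v ≠ vertexPos 3 w := by
    intro v w h h'
    obtain ⟨q, -, h2, h3⟩ := exists_coord_lt v.code v.code_lt w.code h
    exact (functional_lt h2 h3).ne (congrArg _ h')
  intro v w h
  by_contra hne
  rcases lt_or_gt_of_ne (Vertex.code_injective.ne hne) with h' | h'
  · exact key w v h' h.symm
  · exact key v w h' h

/-! ### Vertex links -/

lemma exists_cornerCode_eq : ∀ v < 54, ∃ f < 66, ∃ i < 4, cornerCode f i = v := by decide +kernel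

lemma exists_faceCorner (v : Vertex) : ∃ f i, faceCorner f i = v := by
  obtain ⟨f, hf, i, hi, h⟩ := exists_cornerCode_eq v.code v.code_lt
  refine ⟨faceOf f, ⟨i, hi⟩, Vertex.code_injective ?_⟩
  rw [code_faceCorner, code_faceOf f hf]
  exact h

/-- The edges of a face at a vertex lead to the two corners next to this vertex. -/
lemma exists_corner_of_hasEdge {f u v : ℕ} (h : hasEdge f u v = true) :
    ∃ j < 4, cornerCode f j = u ∧ (cornerCode f (j + 1) = v ∨ cornerCode f (j + 3) = v) := by
  obtain ⟨i, hi, h | h⟩ := hasEdge_iff.1 h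
  · exact ⟨i, hi, h.1, Or.inl h.2⟩
  -- Here `u` is the second end of the side, and `v` is the corner before it, reached by adding 3
  -- modulo 4.
  · refine ⟨(i + 1) % 4, Nat.mod_lt _ (by norm_num), by rw [cornerCode_mod]; exact h.2, Or.inr ?_⟩
    rw [← h.1, ← cornerCode_mod f i, ← cornerCode_mod]
    congr 1
    omega

lemma cornerCode_inj {f i j : ℕ} (hf : f < 66) (hi : i < 4) (hj : j < 4)
    (h : cornerCode f i = cornerCode f j) : i = j := by
  rcases lt_trichotomy i j with h' | h' | h'
  · exact absurd h.symm (cornerCode_ne f hf j hj i h')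
  · exact h'
  · exact absurd h (cornerCode_ne f hf i hi j h')

lemma sub_val_eq_one_iff {n : ℕ} (hn : 2 ≤ n) (a b : Fin n) :
    (a - b).val = 1 ↔ (a : ℕ) = cyc n b := by
  rw [Fin.sub_def]
  have ha := a.2
  have hb := b.2
  simp only [cyc]
  rcases le_or_gt (b : ℕ) a with h | h
  · rw [show n - (b : ℕ) + a = (a - b) + n by omega, Nat.add_mod_right, Nat.mod_eq_of_lt (by omega)]
    split_ifs <;> omega
  · rw [Nat.mod_eq_of_lt (by omega)]
    split_ifs <;> omega

/-- The vertex with the position `i` in the link of the vertex `v`. -/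
def starVertex (v : Vertex) (i : ℕ) : Vertex := vertexOf ((star v.code).getD i 0)

lemma code_starVertex {v : Vertex} {i : ℕ} (hi : i < (star v.code).length) :
    (starVertex v i).code = (star v.code).getD i 0 := by
  refine code_vertexOf _ (star_lt _ v.code_lt _ ?_)
  rw [List.getD_eq_getElem _ _ hi]
  exact List.getElem_mem hi

lemma starVertex_inj {v : Vertex} {i j : ℕ} (hi : i < (star v.code).length)
    (hj : j < (star v.code).length) (h : starVertex v i = starVertex v j) : i = j := by
  have h := congrArg Vertex.code h
  rw [code_starVertex hi, code_starVertex hj, List.getD_eq_getElem _ _ hi,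
    List.getD_eq_getElem _ _ hj] at h
  exact (nodup_star _ v.code_lt).getElem_inj_iff.1 h

lemma edge_starVertex_mem {v : Vertex} {i : ℕ} (hi : i < (star v.code).length) :
    s(v, starVertex v i) ∈ allEdges := by
  obtain ⟨f, hf, h, -⟩ := exists_face_star v.code_lt hi
  exact mem_edges.2 ⟨f, hf, by rwa [code_starVertex hi]⟩

lemma exists_starVertex {v w : Vertex} (h : s(v, w) ∈ allEdges) :
    ∃ i < (star v.code).length, starVertex v i = w := by
  obtain ⟨f, hf, h⟩ := mem_edges.1 h
  have hw : w.code ∈ star v.code := by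
    obtain ⟨i, hi, h | h⟩ := hasEdge_iff.1 h
    · rw [← h.1, ← h.2]; exact (corner_mem_star f hf i hi).1
    · rw [← h.1, ← h.2]; exact (corner_mem_star f hf i hi).2
  obtain ⟨i, hi, h'⟩ := List.getElem_of_mem hw
  refine ⟨i, hi, Vertex.code_injective ?_⟩
  rw [code_starVertex hi, List.getD_eq_getElem _ _ hi, h']

/-- The edges at a vertex that belong to a common face are consecutive in the link. -/
lemma common_face_iff {v : Vertex} {i j : ℕ} (hi : i < (star v.code).length)
    (hj : j < (star v.code).length) (hij : i ≠ j) :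
    (∃ f, s(v, starVertex v i) ∈ edgesOf f ∧ s(v, starVertex v j) ∈ edgesOf f) ↔
      j = cyc (star v.code).length i ∨ i = cyc (star v.code).length j := by
  constructor
  · rintro ⟨f, h1, h2⟩
    rw [mem_faceEdges] at h1 h2
    obtain ⟨a, ha, hav, h1⟩ := exists_corner_of_hasEdge h1
    obtain ⟨b, hb, hbv, h2⟩ := exists_corner_of_hasEdge h2
    obtain rfl := cornerCode_inj f.code_lt ha hb (hav.trans hbv.symm)
    obtain ⟨l, hl, h⟩ := consecutive_star f.code f.code_lt a ha
    rw [hav] at hl h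
    have hl' := cyc_lt hl
    rw [← code_starVertex hl, ← code_starVertex hl'] at h
    have hc : ∀ {i j}, i < (star v.code).length → j < (star v.code).length →
        (starVertex v i).code = (starVertex v j).code → i = j := fun hi hj h =>
      starVertex_inj hi hj (Vertex.code_injective h)
    rcases h1 with h1 | h1 <;> rcases h2 with h2 | h2
    · exact absurd (hc hi hj (h1.symm.trans h2)) hij
    · rcases h with h | h
      · have e1 := hc hl hi (h.1.trans h1)
        have e2 := hc hl' hj (h.2.trans h2)
        left; rw [← e1, e2]
      · have e1 := hc hl hj (h.1.trans h2)
        have e2 := hc hl' hi (h.2.trans h1)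
        right; rw [← e1, e2]
    · rcases h with h | h
      · have e1 := hc hl hj (h.1.trans h2)
        have e2 := hc hl' hi (h.2.trans h1)
        right; rw [← e1, e2]
      · have e1 := hc hl hi (h.1.trans h1)
        have e2 := hc hl' hj (h.2.trans h2)
        left; rw [← e1, e2]
    · exact absurd (hc hi hj (h1.symm.trans h2)) hij
  · have key : ∀ {i}, i < (star v.code).length → ∃ f, s(v, starVertex v i) ∈ edgesOf f ∧
        s(v, starVertex v (cyc (star v.code).length i)) ∈ edgesOf f := by
      intro i hi
      obtain ⟨f, hf, h1, h2⟩ := exists_face_star v.code_lt hi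
      refine ⟨faceOf f, mem_faceEdges.2 ?_, mem_faceEdges.2 ?_⟩
      · rwa [code_faceOf f hf, code_starVertex hi]
      · rwa [code_faceOf f hf, code_starVertex (cyc_lt hi)]
    rintro (rfl | rfl)
    · exact key hi
    · obtain ⟨f, h1, h2⟩ := key hj
      exact ⟨f, h2, h1⟩

/-- The list `star` enumerates the edges at the vertex without repetition, and a common face means
cyclically consecutive positions; so positions in the list give the isomorphism with the cycle
graph. -/
lemma link_cycle (v : Vertex) :
    ∃ k, 3 ≤ k ∧ Nonempty ((cubedOctopus 3).link v ≃g SimpleGraph.cycleGraph k) := by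
  set n := (star v.code).length with hn
  have h3 : 3 ≤ n := three_le_length_star v.code v.code_lt
  refine ⟨n, h3, ⟨RelIso.symm ?_⟩⟩
  let φ : Fin n → {e : Sym2 Vertex // e ∈ allEdges ∧ v ∈ e} := fun i =>
    ⟨s(v, starVertex v i), edge_starVertex_mem i.2, Sym2.mem_mk_left _ _⟩
  have hinj : Function.Injective φ := by
    intro i j h
    exact Fin.ext (starVertex_inj i.2 j.2 (Sym2.congr_right.1 (congrArg Subtype.val h)))
  have hsurj : Function.Surjective φ := by
    rintro ⟨e, he, hv⟩
    obtain ⟨w, rfl⟩ := hv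
    obtain ⟨i, hi, rfl⟩ := exists_starVertex he
    exact ⟨⟨i, hi⟩, rfl⟩
  refine ⟨Equiv.ofBijective φ ⟨hinj, hsurj⟩, ?_⟩
  intro i j
  have : NeZero n := ⟨by omega⟩
  rw [SimpleGraph.cycleGraph_adj']
  rw [sub_val_eq_one_iff (by omega), sub_val_eq_one_iff (by omega)]
  change (φ i ≠ φ j ∧ ∃ f, s(v, starVertex v i) ∈ edgesOf f ∧ s(v, starVertex v j) ∈ edgesOf f) ↔ _
  constructor
  · rintro ⟨h, hf⟩
    have hij : (i : ℕ) ≠ j := fun h' => h (congrArg φ (Fin.ext h'))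
    exact ((common_face_iff i.2 j.2 hij).1 hf).symm
  · intro h
    have hij : (i : ℕ) ≠ j := by
      intro h'
      have := j.2
      rw [h'] at h
      simp only [cyc] at h
      rcases h with h | h <;> split_ifs at h <;> omega
    exact ⟨fun h' => hij (congrArg Fin.val (hinj h')), (common_face_iff i.2 j.2 hij).2 h.symm⟩

theorem isPolyhedron : (cubedOctopus 3).IsPolyhedron where
  finite_V := Finite.of_equiv _ vertexEquiv.symm
  finite_F := Finite.of_equiv _ faceEquiv.symm
  pos_injective := vertexPos_injective
  vertex_mem := exists_faceCorner
  face := isPlanarPolygon_face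
  inter f g h := by
    rcases faceRegion_inter h with h | ⟨i, j, hij, h⟩ | ⟨i, j, hij, h⟩
    · exact Or.inl h
    · exact Or.inr (Or.inl ⟨i, j, hij, h⟩)
    · refine Or.inr (Or.inr ⟨faceCorner f i, faceCorner f (finRotate 4 i), ⟨i, rfl⟩, ?_, h⟩)
      refine ⟨j, Sym2.eq_iff.2 ?_⟩
      exact hij.imp (And.imp Eq.symm Eq.symm) fun h => ⟨h.2.symm, h.1.symm⟩
  two_faces := two_faces
  link_cycle := link_cycle

/-! ### Genus and dihedral angles -/

/-- This makes the union of the faces connected by induction: each new face is convex and touches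
the union of its predecessors. -/
lemma exists_earlier_face : ∀ f < 66, 0 < f → ∃ g < f, ∃ i < 4, isCommon f g i = true := by
  decide +kernel

lemma isConnected_faces (n : ℕ) (hn : n < 66) :
    IsConnected (⋃ k ≤ n, faceRegion (faceOf k)) := by
  have hc : ∀ f, IsConnected (faceRegion f) := fun f =>
    ⟨⟨_, facePos_mem f 0⟩, (convex_convexHull ℝ _).isPreconnected⟩
  induction n with
  | zero => simpa using hc (faceOf 0)
  | succ n ih =>
    have : ⋃ k ≤ n + 1, faceRegion (faceOf k) =
        (⋃ k ≤ n, faceRegion (faceOf k)) ∪ faceRegion (faceOf (n + 1)) :=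
      Set.biUnion_le_succ (fun k => faceRegion (faceOf k)) n
    rw [this]
    refine IsConnected.union ?_ (ih (by omega)) (hc _)
    obtain ⟨g, hg, i, hi, h⟩ := exists_earlier_face (n + 1) hn (by omega)
    have e1 := code_faceOf (n + 1) hn
    have e2 := code_faceOf g (by omega)
    rw [← e1, ← e2] at h
    obtain ⟨j, hj⟩ := isCommon_iff (i := ⟨i, hi⟩).1 h
    refine ⟨facePos (faceOf g) j, Set.mem_biUnion (show g ≤ n by omega) (facePos_mem _ j), ?_⟩
    rw [facePos, hj]
    exact facePos_mem _ _

lemma carrier_eq : (cubedOctopus 3).carrier = ⋃ f, faceRegion f := rfl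

theorem hasGenus : (cubedOctopus 3).HasGenus 7 := by
  refine ⟨?_, ?_⟩
  · have h := isConnected_faces 65 (by norm_num)
    have : ⋃ k ≤ 65, faceRegion (faceOf k) = (cubedOctopus 3).carrier := by
      rw [carrier_eq]
      apply Set.Subset.antisymm
      · exact Set.iUnion₂_subset fun k _ => Set.subset_iUnion _ _
      · refine Set.iUnion_subset fun f => ?_
        have hf := f.code_lt
        rw [← faceOf_code f]
        exact Set.subset_biUnion_of_mem (u := fun k => faceRegion (faceOf k))
          (show f.code ∈ {k | k ≤ 65} by simp; omega)
    rwa [this] at h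
  · have hV : Nat.card (cubedOctopus 3).V = 54 := (Nat.card_congr vertexEquiv).trans (by simp)
    have hF : Nat.card (cubedOctopus 3).F = 66 := (Nat.card_congr faceEquiv).trans (by simp)
    have hE : (cubedOctopus 3).edges.ncard = 132 := ncard_edges
    rw [hV, hF, hE]
    norm_num

/-- The inward normal, at the edge between two apexes, of one of the two faces at this edge. -/
noncomputable def innerNormal (τ : ℤˣ) : E3 := !₂[((τ : ℤ) : ℝ) / √3, 1 / √3, 1 / √3]

lemma sq_sign (τ : ℤˣ) : (((τ : ℤ) : ℝ)) ^ 2 = 1 := by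
  rcases Int.units_eq_one_or τ with rfl | rfl <;> norm_num

lemma isInwardNormal_inner (τ : ℤˣ) : IsInwardNormal (faceRegion (.inner 0 τ 1 1))
    (vertexPos 3 (.apex 1 1)) (vertexPos 3 (.apex 2 1)) (innerNormal τ) where
  unit := by
    rw [EuclideanSpace.norm_eq, Real.sqrt_eq_one]
    simp only [innerNormal, Fin.sum_univ_three, Real.norm_eq_abs, sq_abs]
    simp [div_pow, sq_sign]
    norm_num
  perp := by
    rw [EuclideanSpace.inner_eq_star_dotProduct]
    simp [dotProduct, Fin.sum_univ_three, innerNormal, vertexPos]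
  inward := by
    have h3 : 0 < √3 := by positivity
    -- The rectangle has width √3/2 in the direction of the normal.
    have hI : Set.Ioo 0 (√3 / 2) ∈ 𝓝[>] (0 : ℝ) := Ioo_mem_nhdsGT (by positivity)
    filter_upwards [hI] with t ht
    have hK : Convex ℝ (faceRegion (.inner 0 τ 1 1)) := convex_convexHull ℝ _
    have hm := facePos_mem (.inner 0 τ 1 1)
    have m1 := hK (hm 0) (hm 1) (a := 1 / 2) (b := 1 / 2) (by norm_num) (by norm_num) (by norm_num)
    have m2 := hK (hm 3) (hm 2) (a := 1 / 2) (b := 1 / 2) (by norm_num) (by norm_num) (by norm_num)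
    have hl : 2 * t / √3 ≤ 1 := by
      rw [div_le_one h3]; linarith [ht.2]
    -- The midpoint of the opposite side differs from that of the edge by `(τ, 1, 1) / 2`, which is
    -- √3/2 times the normal; hence the weight `2 * t / √3`.
    have m := hK m1 m2 (a := 1 - 2 * t / √3) (b := 2 * t / √3) (by linarith)
      (by have := ht.1; positivity) (by ring)
    convert m using 1
    ext i
    fin_cases i <;>
      simp [midpoint_eq_smul_add, facePos, faceCorner, vertexPos, innerNormal, signs] <;>
      field_simp <;> ring

theorem not_isOrthogonal : ¬ (cubedOctopus 3).IsOrthogonal := by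
  intro h
  have he : ∀ τ, s(Vertex.apex 1 1, Vertex.apex 2 1) ∈ edgesOf (.inner 0 τ 1 1) :=
    fun τ => ⟨0, rfl⟩
  have hne : Face.inner 0 1 1 1 ≠ Face.inner 0 (-1) 1 1 := by
    intro h
    have := congrArg Face.code h
    revert this
    decide
  obtain ⟨k, hk⟩ := h (.inner 0 1 1 1) (.inner 0 (-1) 1 1) hne (.apex 1 1) (.apex 2 1) (he 1) (he _)
    _ _ (isInwardNormal_inner 1) (isInwardNormal_inner (-1))
  have hi : inner ℝ (innerNormal 1) (innerNormal (-1)) = 1 / 3 := by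
    have h3 : √3 * √3 = 3 := Real.mul_self_sqrt (by norm_num)
    rw [EuclideanSpace.inner_eq_star_dotProduct]
    simp [dotProduct, Fin.sum_univ_three, innerNormal]
    field_simp
    nlinarith
  have hc : Real.cos (InnerProductGeometry.angle (innerNormal 1) (innerNormal (-1))) = 1 / 3 := by
    rw [InnerProductGeometry.cos_angle, hi, (isInwardNormal_inner 1).unit,
      (isInwardNormal_inner (-1)).unit]
    norm_num
  rw [hk] at hc
  -- For a multiple θ of π/2, cos 2θ is 1 or -1 in absolute value 1, whereas cos θ = 1/3 gives cos
  -- 2θ = -7/9.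
  have h2 := Real.cos_two_mul (k * (Real.pi / 2))
  rw [hc, show 2 * ((k : ℝ) * (Real.pi / 2)) = k * Real.pi by ring] at h2
  have h1 := Real.abs_cos_int_mul_pi k
  rw [h2] at h1
  norm_num [abs_of_neg] at h1

/-! ### The net -/

/-- The numbers `(a, b)` such that the grid line `n` has the distance `a + b * √3 / 2` from the grid
line `0`, if the list `l` contains such numbers for the widths of the gaps between grid lines. -/
def gridInt (l : List (ℕ × ℕ)) : ℕ → ℕ × ℕ
  | 0 => (0, 0)
  -- The default gap `(1, 0)` continues the grid beyond the list, so that it is strictly increasing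
  -- on all of ℕ.
  | n + 1 => gridInt l n + l.getD n (1, 0)

/-- The position of a grid line. -/
noncomputable def gridLine (l : List (ℕ × ℕ)) (n : ℕ) : ℝ :=
  (gridInt l n).1 + (gridInt l n).2 * (√3 / 2)

lemma strictMono_gridLine {l : List (ℕ × ℕ)} (h : ∀ p ∈ l, 0 < p.1 + p.2) :
    StrictMono (gridLine l) := by
  refine strictMono_nat_of_lt_succ fun n => ?_
  have hp : 0 < (l.getD n (1, 0)).1 + (l.getD n (1, 0)).2 := by
    rcases lt_or_ge n l.length with hn | hn
    · rw [List.getD_eq_getElem _ _ hn]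
      exact h _ (List.getElem_mem hn)
    · rw [List.getD_eq_default _ _ hn]
      norm_num
  have h3 : 0 < √3 / 2 := by positivity
  simp only [gridLine, gridInt, Prod.fst_add, Prod.snd_add]
  push_cast
  rcases Nat.add_pos_iff_pos_or_pos.1 hp with hp | hp
  · have : (0 : ℝ) < (l.getD n (1, 0)).1 := Nat.cast_pos.2 hp
    have : (0 : ℝ) ≤ (l.getD n (1, 0)).2 * (√3 / 2) := by positivity
    linarith
  · have : (0 : ℝ) < (l.getD n (1, 0)).2 * (√3 / 2) := mul_pos (Nat.cast_pos.2 hp) h3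
    have : (0 : ℝ) ≤ (l.getD n (1, 0)).1 := by positivity
    linarith

/-- The widths of the gaps between the vertical grid lines of the net. -/
def gapsX : List (ℕ × ℕ) :=
  [(1, 0), (1, 0), (1, 0), (1, 0), (0, 1), (0, 1), (1, 0), (0, 1), (0, 1), (1, 0), (1, 0),
    (1, 0), (1, 0), (0, 1), (0, 1)]

/-- The widths of the gaps between the horizontal grid lines of the net. -/
def gapsY : List (ℕ × ℕ) :=
  -- A prism of length 3 occupies either one gap of width 3 or three consecutive unit gaps; for `L =
  -- 3` both fit the same grid.
  [(1, 0), (3, 0), (1, 0), (1, 0), (1, 0), (3, 0), (1, 0), (1, 0), (1, 0), (3, 0), (1, 0),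
    (1, 0), (1, 0), (3, 0), (1, 0)]

lemma strictMono_gapsX : StrictMono (gridLine gapsX) := strictMono_gridLine (by decide)

lemma strictMono_gapsY : StrictMono (gridLine gapsY) := strictMono_gridLine (by decide)

/-- The grid points at which the net places the corners of the faces. -/
def panelTable : List (List (ℕ × ℕ)) := [
  [(14, 10), (14, 13), (15, 13), (15, 10)], [(14, 5), (14, 6), (13, 6), (13, 5)],
  [(5, 9), (5, 10), (4, 10), (4, 9)], [(8, 9), (8, 10), (9, 10), (9, 9)],
  [(5, 2), (5, 5), (4, 5), (4, 2)], [(14, 5), (14, 6), (15, 6), (15, 5)],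
  [(5, 9), (5, 10), (6, 10), (6, 9)], [(8, 9), (8, 10), (7, 10), (7, 9)],
  [(14, 13), (14, 14), (15, 14), (15, 13)], [(5, 5), (5, 6), (4, 6), (4, 5)],
  [(14, 6), (14, 9), (13, 9), (13, 6)], [(8, 5), (8, 6), (9, 6), (9, 5)],
  [(14, 13), (14, 14), (13, 14), (13, 13)], [(5, 5), (5, 6), (6, 6), (6, 5)],
  [(8, 10), (8, 13), (9, 13), (9, 10)], [(8, 5), (8, 6), (7, 6), (7, 5)],
  [(14, 9), (14, 10), (15, 10), (15, 9)], [(8, 13), (8, 14), (7, 14), (7, 13)],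
  [(5, 1), (5, 2), (4, 2), (4, 1)], [(5, 6), (5, 9), (6, 9), (6, 6)],
  [(14, 9), (14, 10), (13, 10), (13, 9)], [(8, 13), (8, 14), (9, 14), (9, 13)],
  [(5, 1), (5, 2), (6, 2), (6, 1)], [(8, 6), (8, 9), (7, 9), (7, 6)],
  [(10, 5), (11, 5), (11, 6), (10, 6)], [(13, 5), (12, 5), (12, 6), (13, 6)],
  [(12, 9), (11, 9), (11, 10), (12, 10)], [(9, 9), (10, 9), (10, 10), (9, 10)],
  [(12, 13), (13, 13), (13, 14), (12, 14)], [(4, 5), (3, 5), (3, 6), (4, 6)],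
  [(4, 13), (3, 13), (3, 14), (4, 14)], [(2, 10), (1, 10), (1, 9), (2, 9)],
  [(11, 1), (12, 1), (12, 2), (11, 2)], [(7, 13), (6, 13), (6, 14), (7, 14)],
  [(7, 1), (6, 1), (6, 2), (7, 2)], [(6, 6), (7, 6), (7, 9), (6, 9)],
  [(10, 5), (11, 5), (11, 4), (10, 4)], [(13, 5), (12, 5), (12, 4), (13, 4)],
  [(12, 9), (11, 9), (11, 8), (12, 8)], [(9, 9), (10, 9), (10, 8), (9, 8)],
  [(12, 13), (13, 13), (13, 12), (12, 12)], [(10, 12), (10, 11), (11, 11), (11, 12)],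
  [(4, 13), (3, 13), (3, 12), (4, 12)], [(2, 10), (1, 10), (1, 11), (2, 11)],
  [(12, 14), (11, 14), (11, 15), (12, 15)], [(7, 13), (6, 13), (6, 12), (7, 12)],
  [(3, 9), (2, 9), (2, 8), (3, 8)], [(3, 6), (2, 6), (2, 7), (3, 7)],
  [(12, 13), (11, 13), (11, 12), (12, 12)], [(3, 10), (2, 10), (2, 11), (3, 11)],
  [(12, 10), (11, 10), (11, 11), (12, 11)], [(3, 13), (2, 13), (2, 12), (3, 12)],
  [(12, 14), (13, 14), (13, 15), (12, 15)], [(4, 6), (3, 6), (3, 7), (4, 7)],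
  [(11, 14), (10, 14), (10, 15), (11, 15)], [(2, 9), (1, 9), (1, 8), (2, 8)],
  [(11, 2), (12, 2), (12, 3), (11, 3)], [(7, 14), (6, 14), (6, 15), (7, 15)],
  [(11, 5), (12, 5), (12, 4), (11, 4)], [(11, 9), (10, 9), (10, 8), (11, 8)],
  [(7, 11), (6, 11), (6, 12), (7, 12)], [(3, 8), (2, 8), (2, 7), (3, 7)],
  [(11, 3), (11, 4), (12, 4), (12, 3)], [(11, 7), (11, 8), (10, 8), (10, 7)],
  [(12, 12), (12, 11), (11, 11), (11, 12)], [(3, 11), (3, 12), (2, 12), (2, 11)]]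

/-- The grid point of the corner `i` (modulo 4) of the face number `f` in the net. -/
def panelCorner (f i : ℕ) : ℕ × ℕ := (panelTable.getD f []).getD (i % 4) (0, 0)

/-- The panel of the net that is folded to the face number `f`. -/
def panelBox (f : ℕ) : Box := spanBox (panelCorner f 0) (panelCorner f 2)

/-- The panels of the net. -/
def panelBoxes : List Box := (List.range 66).map panelBox

/-- The corners of the net. -/
def netTable : List (ℕ × ℕ) := [
  (1, 8), (1, 11), (2, 11), (2, 13), (3, 13), (3, 14), (4, 14), (4, 12), (3, 12), (3, 10),
  (2, 10), (2, 9), (3, 9), (3, 7), (4, 7), (4, 6), (5, 6), (5, 9), (4, 9), (4, 10), (6, 10),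
  (6, 9), (7, 9), (7, 10), (8, 10), (8, 13), (7, 13), (7, 11), (6, 11), (6, 15), (7, 15), (7, 14),
  (9, 14), (9, 10), (10, 10), (10, 9), (11, 9), (11, 11), (10, 11), (10, 12), (11, 12), (11, 13),
  (12, 13), (12, 14), (10, 14), (10, 15), (13, 15), (13, 14), (15, 14), (15, 9), (14, 9), (14, 6),
  (15, 6), (15, 5), (13, 5), (13, 4), (12, 4), (12, 1), (11, 1), (11, 4), (10, 4), (10, 6),
  (11, 6), (11, 5), (12, 5), (12, 6), (13, 6), (13, 10), (14, 10), (14, 13), (13, 13), (13, 12),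
  (12, 12), (12, 8), (11, 8), (11, 7), (10, 7), (10, 8), (9, 8), (9, 9), (8, 9), (8, 6), (9, 6),
  (9, 5), (7, 5), (7, 6), (6, 6), (6, 5), (5, 5), (5, 2), (7, 2), (7, 1), (4, 1), (4, 5), (3, 5),
  (3, 6), (2, 6), (2, 8)]

/-- The corner `i` of the net. -/
def netCorner (i : ℕ) : ℕ × ℕ := netTable.getD i (0, 0)

set_option maxRecDepth 4000 in
lemma isGridNet_net : IsGridNet 98 netCorner 16 panelBoxes where
  three_le := by norm_num
  turn := by decide +kernel
  distinct := by decide +kernel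
  consecutive := by decide +kernel
  disjoint := by decide +kernel
  corner_lt := by decide +kernel
  box_le := by decide +kernel
  proper := by decide +kernel
  frontier_cell := by decide +kernel

/-! ### Finite checks on the panels of the net -/

lemma isCornerCycle_panel : ∀ f < 66, IsCornerCycle (panelBox f) fun j => panelCorner f j := by
  decide +kernel

/-- Whether the corner `i` of the face number `f` is also a corner of the face number `g`, at the
same place of the net. -/
def isShared (f g i : ℕ) : Bool := (List.range 4).any fun j =>
  (cornerCode g j).beq (cornerCode f i) && decide (panelCorner g j = panelCorner f i)

/-- The side `i` of the panel number `f`. -/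
def panelSide (f i : ℕ) : Box := spanBox (panelCorner f i) (panelCorner f (i + 1))

/-- Whether the side `i` of the panel number `f` belongs to the perimeter of the net. -/
def onPerimeter (f i : ℕ) : Bool := (sideBoxes 98 netCorner).any (panelSide f i).isSub

/-- Panels touch only in a whole side or a corner, with the same vertices of the polyhedron at the
same grid points. The case `j = i` is that of a single corner. -/
lemma panels_inter : ((List.range 66).all fun f => (List.range f).all fun g =>
    decide ((panelBox f).inter (panelBox g)).IsVoid ||
    (List.range 4).any fun i => [i, i + 1].any fun j => isShared f g i && isShared f g j &&
      decide ((panelBox f).inter (panelBox g) =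
        spanBox (panelCorner f i) (panelCorner f j))) = true := by
  decide +kernel

/-- Each edge common to two faces is either a crease, with both panels attached along it, or a cut,
and then the side is on the perimeter. -/
lemma shared_or_onPerimeter : ((List.range 66).all fun f => (List.range 66).all fun g =>
    (List.range 4).all fun i => f.beq g || !isCommon f g i || !isCommon f g (i + 1) ||
      (isShared f g i && isShared f g (i + 1)) || onPerimeter f i) = true := by
  decide +kernel

/-- No vertex of the polyhedron is in the interior of the net, so faces that meet in a single vertex
cause no forbidden gluing. -/
lemma corner_onPerimeter : ((List.range 66).all fun f => (List.range 4).all fun i =>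
    (sideBoxes 98 netCorner).any (spanBox (panelCorner f i) (panelCorner f i)).isSub) = true := by
  decide +kernel

/-- The differences of two grid points in the horizontal and the vertical direction. -/
def gridDiff (l : List (ℕ × ℕ)) (a b : ℕ) : ℤ × ℤ :=
  ((gridInt l a).1 - (gridInt l b).1, (gridInt l a).2 - (gridInt l b).2)

/-- Whether the vector `b a` between grid points is as long as the vector `d c` between numbered
vertices. -/
def sameLength (a b : ℕ × ℕ) (c d : ℕ) : Bool :=
  let u := gridDiff gapsX a.1 b.1
  let v := gridDiff gapsY a.2 b.2
  -- For a length `a + b * √3 / 2` with `a * b = 0`, eight times the square is the integer `8 * a ^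
  -- 2 + 6 * b ^ 2`, in the scale of `gramInt`.
  decide (u.1 * u.2 = 0) && decide (v.1 * v.2 = 0) &&
    decide (8 * (u.1 ^ 2 + v.1 ^ 2) + 6 * (u.2 ^ 2 + v.2 ^ 2) = (gramInt c d c d).1)

lemma sameLength_panel : ((List.range 66).all fun f =>
    sameLength (panelCorner f 1) (panelCorner f 0) (cornerCode f 1) (cornerCode f 0) &&
    sameLength (panelCorner f 3) (panelCorner f 0) (cornerCode f 3) (cornerCode f 0)) = true := by
  decide +kernel

/-- A point of a box lies on one of its four sides or has the box as a neighbourhood. -/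
lemma IsCornerCycle.mem_nhds_or {B : Box} {c : Fin 4 → ℕ × ℕ} {xs ys : ℕ → ℝ}
    (h : IsCornerCycle B c) {p : E2} (hp : p ∈ B.toSet xs ys) :
    B.toSet xs ys ∈ 𝓝 p ∨ ∃ i, p ∈ (spanBox (c i) (c (finRotate 4 i))).toSet xs ys := by
  obtain ⟨rfl, h⟩ := h
  have hp0 := hp
  obtain ⟨⟨h1, h2⟩, h3, h4⟩ := hp
  simp only [spanBox] at h1 h2 h3 h4
  have r0 : finRotate 4 0 = 1 := by decide
  have r1 : finRotate 4 1 = 2 := by decide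
  have r2 : finRotate 4 2 = 3 := by decide
  have r3 : finRotate 4 3 = 0 := by decide
  by_cases e1 : p 0 = xs (c 0).1
  · right
    rcases h with ⟨k1, k3⟩ | ⟨k1, k3⟩
    · refine ⟨3, ?_⟩
      rw [r3, k3]
      simp only [spanBox, Box.toSet, Set.mem_ofPred_eq, min_self, max_self, min_comm (c 2).2,
        max_comm (c 2).2]
      exact ⟨⟨e1.ge, e1.le⟩, h3, h4⟩
    · refine ⟨0, ?_⟩
      rw [r0, k1]
      simp only [spanBox, Box.toSet, Set.mem_ofPred_eq, min_self, max_self]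
      exact ⟨⟨e1.ge, e1.le⟩, h3, h4⟩
  by_cases e2 : p 0 = xs (c 2).1
  · right
    rcases h with ⟨k1, k3⟩ | ⟨k1, k3⟩
    · refine ⟨1, ?_⟩
      rw [r1, k1]
      simp only [spanBox, Box.toSet, Set.mem_ofPred_eq, min_self, max_self]
      exact ⟨⟨e2.ge, e2.le⟩, h3, h4⟩
    · refine ⟨2, ?_⟩
      rw [r2, k3]
      simp only [spanBox, Box.toSet, Set.mem_ofPred_eq, min_self, max_self, min_comm (c 2).2,
        max_comm (c 2).2]
      exact ⟨⟨e2.ge, e2.le⟩, h3, h4⟩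
  by_cases e3 : p 1 = ys (c 0).2
  · right
    rcases h with ⟨k1, k3⟩ | ⟨k1, k3⟩
    · refine ⟨0, ?_⟩
      rw [r0, k1]
      simp only [spanBox, Box.toSet, Set.mem_ofPred_eq, min_self, max_self]
      exact ⟨⟨h1, h2⟩, e3.ge, e3.le⟩
    · refine ⟨3, ?_⟩
      rw [r3, k3]
      simp only [spanBox, Box.toSet, Set.mem_ofPred_eq, min_self, max_self, min_comm (c 2).1,
        max_comm (c 2).1]
      exact ⟨⟨h1, h2⟩, e3.ge, e3.le⟩
  by_cases e4 : p 1 = ys (c 2).2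
  · right
    rcases h with ⟨k1, k3⟩ | ⟨k1, k3⟩
    · refine ⟨2, ?_⟩
      rw [r2, k3]
      simp only [spanBox, Box.toSet, Set.mem_ofPred_eq, min_self, max_self, min_comm (c 2).1,
        max_comm (c 2).1]
      exact ⟨⟨h1, h2⟩, e4.ge, e4.le⟩
    · refine ⟨1, ?_⟩
      rw [r1, k1]
      simp only [spanBox, Box.toSet, Set.mem_ofPred_eq, min_self, max_self]
      exact ⟨⟨h1, h2⟩, e4.ge, e4.le⟩
  left
  have key : ∀ {zs : ℕ → ℝ} {t : ℝ} {a b : ℕ}, zs (min a b) ≤ t → t ≤ zs (max a b) → t ≠ zs a →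
      t ≠ zs b → Set.Ioo (zs (min a b)) (zs (max a b)) ∈ 𝓝 t := by
    intro zs t a b l u ha hb
    refine Ioo_mem_nhds (lt_of_le_of_ne l ?_) (lt_of_le_of_ne u ?_)
    · rcases min_choice a b with h | h <;> rw [h]
      exacts [Ne.symm ha, Ne.symm hb]
    · rcases max_choice a b with h | h <;> rw [h]
      exacts [ha, hb]
  filter_upwards [(continuous_coord 0).tendsto p (key h1 h2 e1 e2),
    (continuous_coord 1).tendsto p (key h3 h4 e3 e4)] with q hq0 hq1
  exact ⟨⟨hq0.1.le, hq0.2.le⟩, hq1.1.le, hq1.2.le⟩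

/-! ### The folding -/

/-- The corners of the panel of a face. -/
noncomputable def panelPos (f : Face) (i : Fin 4) : E2 :=
  gridPt (gridLine gapsX) (gridLine gapsY) (panelCorner f.code i)

/-- The panel of a face. -/
def panel (f : Face) : Set E2 := (panelBox f.code).toSet (gridLine gapsX) (gridLine gapsY)

lemma convexHull_panelPos (f : Face) : convexHull ℝ (Set.range (panelPos f)) = panel f :=
  (isCornerCycle_panel f.code f.code_lt).convexHull_eq strictMono_gapsX strictMono_gapsY

lemma panelPos_mem (f : Face) (i : Fin 4) : panelPos f i ∈ panel f := by
  rw [← convexHull_panelPos]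
  exact subset_convexHull ℝ _ ⟨i, rfl⟩

lemma gridLine_sub_sq {l : List (ℕ × ℕ)} {a b : ℕ}
    (h : (gridDiff l a b).1 * (gridDiff l a b).2 = 0) :
    (gridLine l a - gridLine l b) ^ 2 =
      (8 * (gridDiff l a b).1 ^ 2 + 6 * (gridDiff l a b).2 ^ 2) / 8 := by
  have h' : ((gridDiff l a b).1 * (gridDiff l a b).2 : ℝ) = 0 := by exact_mod_cast h
  have h3 : √3 ^ 2 = 3 := Real.sq_sqrt (by norm_num)
  simp only [gridLine, gridDiff] at *
  push_cast at *
  linear_combination √3 * h' + ((gridInt l a).2 - (gridInt l b).2 : ℝ) ^ 2 / 4 * h3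

lemma normSq_gridPt_sub {xs ys : ℕ → ℝ} (a b : ℕ × ℕ) :
    ‖gridPt xs ys a - gridPt xs ys b‖ ^ 2 = (xs a.1 - xs b.1) ^ 2 + (ys a.2 - ys b.2) ^ 2 := by
  rw [EuclideanSpace.norm_sq_eq]
  simp [Fin.sum_univ_two, gridPt]

lemma normSq_of_sameLength {a b : ℕ × ℕ} {c d : ℕ} (h : sameLength a b c d = true) :
    ‖gridPt (gridLine gapsX) (gridLine gapsY) a - gridPt (gridLine gapsX) (gridLine gapsY) b‖ ^ 2 =
      ((gramInt c d c d).1 : ℝ) / 8 := by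
  simp only [sameLength, Bool.and_eq_true, decide_eq_true_eq] at h
  obtain ⟨⟨h1, h2⟩, h3⟩ := h
  rw [normSq_gridPt_sub, gridLine_sub_sq h1, gridLine_sub_sq h2, ← h3]
  push_cast
  ring

lemma norm_panelPos (f : Face) : ‖panelPos f 1 - panelPos f 0‖ = ‖facePos f 1 - facePos f 0‖ ∧
    ‖panelPos f 3 - panelPos f 0‖ = ‖facePos f 3 - facePos f 0‖ := by
  have h := sameLength_panel
  simp only [List.all_eq_true, List.mem_range, Bool.and_eq_true] at h
  obtain ⟨h1, h3⟩ := h f.code f.code_lt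
  constructor
  · rw [← sq_eq_sq₀ (norm_nonneg _) (norm_nonneg _), normSq_facePos_one]
    exact normSq_of_sameLength h1
  · rw [← sq_eq_sq₀ (norm_nonneg _) (norm_nonneg _), normSq_facePos_three]
    exact normSq_of_sameLength h3

lemma exists_panelMap (f : Face) : ∃ φ : E2 →ᵃⁱ[ℝ] E3, ∀ j, φ (panelPos f j) = facePos f j := by
  obtain ⟨n1, n3⟩ := norm_panelPos f
  have hc := (isCornerCycle_panel f.code f.code_lt).2
  simp only [Fin.val_zero, Fin.val_one, Fin.val_two, val_three] at hc
  refine exists_isometry_rect _ _ ?_ (facePos_parallelogram f) n1 n3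
    (n1 ▸ norm_facePos_one_ne f) (n3 ▸ norm_facePos_three_ne f) ?_ (facePos_perp f)
  · simp only [panelPos, Fin.val_zero, Fin.val_one, Fin.val_two, val_three]
    rcases hc with ⟨h1, h3⟩ | ⟨h1, h3⟩ <;> rw [h1, h3] <;>
      refine E2_ext ?_ ?_ <;> simp [gridPt]
  · rw [EuclideanSpace.inner_eq_star_dotProduct]
    simp only [panelPos, Fin.val_zero, Fin.val_one, val_three]
    rcases hc with ⟨h1, h3⟩ | ⟨h1, h3⟩ <;> rw [h1, h3] <;>
      simp [gridPt, dotProduct, Fin.sum_univ_two]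

/-- The rigid motion that carries the panel of a face onto this face. -/
noncomputable def panelMap (f : Face) : E2 →ᵃⁱ[ℝ] E3 := (exists_panelMap f).choose

lemma panelMap_panelPos (f : Face) (j : Fin 4) : panelMap f (panelPos f j) = facePos f j :=
  (exists_panelMap f).choose_spec j

lemma panelMap_image (f : Face) : panelMap f '' panel f = faceRegion f := by
  rw [← convexHull_panelPos, affineIsometry_image_convexHull]
  simp only [panelMap_panelPos]
  rfl

lemma exists_of_isShared {f g : Face} {i : ℕ} (h : isShared f.code g.code i = true) :
    ∃ j : Fin 4, cornerCode g.code j = cornerCode f.code i ∧ panelPos g j =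
      gridPt (gridLine gapsX) (gridLine gapsY) (panelCorner f.code i) := by
  simp only [isShared, List.any_eq_true, List.mem_range, Bool.and_eq_true, Nat.beq_eq,
    decide_eq_true_eq] at h
  obtain ⟨j, hj, h1, h2⟩ := h
  exact ⟨⟨j, hj⟩, h1, congrArg (gridPt (gridLine gapsX) (gridLine gapsY)) h2⟩

lemma panelMap_eq_of_isShared {f g : Face} {i : Fin 4} (h : isShared f.code g.code i = true) :
    panelPos f i ∈ panel g ∧ panelMap f (panelPos f i) = panelMap g (panelPos f i) := by
  obtain ⟨j, h1, h2⟩ := exists_of_isShared h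
  have h2 : panelPos g j = panelPos f i := h2
  have h1 : faceCorner g j = faceCorner f i :=
    Vertex.code_injective (by rw [code_faceCorner, code_faceCorner]; exact h1)
  refine ⟨h2 ▸ panelPos_mem g j, ?_⟩
  rw [panelMap_panelPos, ← h2, panelMap_panelPos, facePos, facePos, h1]

lemma panelCorner_mod (f i : ℕ) : panelCorner f (i % 4) = panelCorner f i := by
  simp [panelCorner]

lemma isShared_mod {f g i : ℕ} : isShared f g (i % 4) = isShared f g i := by
  simp only [isShared, cornerCode_mod, panelCorner_mod]

lemma eq_on_segment {φ ψ : E2 →ᵃⁱ[ℝ] E3} {p q x : E2} (hp : φ p = ψ p) (hq : φ q = ψ q)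
    (hx : x ∈ segment ℝ p q) : φ x = ψ x := by
  rw [segment_eq_image_lineMap] at hx
  obtain ⟨t, -, rfl⟩ := hx
  have h1 := φ.toAffineMap.apply_lineMap p q t
  have h2 := ψ.toAffineMap.apply_lineMap p q t
  simp only [AffineIsometry.coe_toAffineMap] at h1 h2
  rw [h1, h2, hp, hq]

lemma spanBox_panelCorner (f : Face) (i : Fin 4) : segment ℝ (panelPos f i)
    (panelPos f (finRotate 4 i)) =
      (panelSide f.code i).toSet (gridLine gapsX) (gridLine gapsY) := by
  have hc := (isCornerCycle_panel f.code f.code_lt).2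
  simp only [Fin.val_zero, Fin.val_one, Fin.val_two, val_three] at hc
  rw [panelSide, ← panelCorner_mod f.code (i + 1), ← fin4_finRotate_val]
  refine segment_gridPt strictMono_gapsX strictMono_gapsY ?_
  rw [fin4_finRotate_val]
  rcases hc with ⟨h1, h3⟩ | ⟨h1, h3⟩ <;> fin_cases i <;> simp [h1, h3]

/-- Two isometries that agree at the ends of the common side agree along it. This makes `netMap`
independent of the chosen panel and continuous. -/
lemma panelMap_eq {f g : Face} {x : E2} (hf : x ∈ panel f) (hg : x ∈ panel g) :
    panelMap f x = panelMap g x := by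
  have key : ∀ {f g : Face}, g.code < f.code → x ∈ panel f → x ∈ panel g →
      panelMap f x = panelMap g x := by
    intro f g h hf hg
    have hx : x ∈ ((panelBox f.code).inter (panelBox g.code)).toSet (gridLine gapsX)
        (gridLine gapsY) := by
      rw [Box.toSet_inter strictMono_gapsX strictMono_gapsY]
      exact ⟨hf, hg⟩
    have hk := panels_inter
    simp only [List.all_eq_true, List.any_eq_true, List.mem_range, Bool.or_eq_true,
      Bool.and_eq_true, decide_eq_true_eq] at hk
    rcases hk f.code f.code_lt g.code h with hv | ⟨i, hi, j, hj, ⟨h1, h2⟩, he⟩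
    · rw [Box.toSet_eq_empty strictMono_gapsX strictMono_gapsY hv] at hx
      exact hx.elim
    · rw [he] at hx
      have e1 := panelMap_eq_of_isShared (i := ⟨i, hi⟩) h1
      simp only [List.mem_cons, List.not_mem_nil, or_false] at hj
      rcases hj with rfl | rfl
      · have hx : x = panelPos f ⟨j, hi⟩ := by
          simp only [spanBox, min_self, max_self] at hx
          rwa [Box.toSet_point] at hx
        rw [hx, e1.2]
      · have e2 := panelMap_eq_of_isShared (f := f) (g := g) (i := finRotate 4 ⟨i, hi⟩)
          (by rw [fin4_finRotate_val, isShared_mod]; exact h2)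
        refine eq_on_segment e1.2 e2.2 ?_
        rw [spanBox_panelCorner]
        exact hx
  rcases lt_trichotomy f.code g.code with h | h | h
  · exact (key h hg hf).symm
  · rw [Face.code_injective h]
  · exact key h hf hg

/-- The region of the net. -/
def netRegion : Set E2 := boxUnion (gridLine gapsX) (gridLine gapsY) panelBoxes

lemma mem_netRegion {x : E2} : x ∈ netRegion ↔ ∃ f, x ∈ panel f := by
  simp only [netRegion, boxUnion, panelBoxes, List.mem_map, List.mem_range, Set.mem_iUnion,
    exists_prop]
  constructor
  · rintro ⟨_, ⟨f, hf, rfl⟩, hx⟩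
    exact ⟨faceOf f, by rwa [panel, code_faceOf f hf]⟩
  · rintro ⟨f, hx⟩
    exact ⟨_, ⟨f.code, f.code_lt, rfl⟩, hx⟩

open Classical in
/-- The folding of the net. -/
noncomputable def netMap (x : E2) : E3 :=
  -- The value off the net is irrelevant.
  if h : ∃ f, x ∈ panel f then panelMap h.choose x else 0

lemma netMap_eq {f : Face} {x : E2} (h : x ∈ panel f) : netMap x = panelMap f x := by
  have h' : ∃ f, x ∈ panel f := ⟨f, h⟩
  rw [netMap, dif_pos h']
  exact panelMap_eq h'.choose_spec h

/-- The outline of the net. -/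
noncomputable def netPolygon : Polygon E2 98 :=
  gridPolygon (gridLine gapsX) (gridLine gapsY) 98 netCorner

lemma isOrthogonalNet : IsOrthogonalNet netPolygon netRegion :=
  isGridNet_net.isOrthogonalNet strictMono_gapsX strictMono_gapsY

lemma side_subset_frontier {f : Face} {i : Fin 4} (h : onPerimeter f.code i = true) :
    segment ℝ (panelPos f i) (panelPos f (finRotate 4 i)) ⊆ frontier netRegion := by
  rw [spanBox_panelCorner]
  exact isGridNet_net.subset_frontier strictMono_gapsX strictMono_gapsY h

lemma panelPos_mem_frontier (f : Face) (i : Fin 4) : panelPos f i ∈ frontier netRegion := by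
  have h := corner_onPerimeter
  simp only [List.all_eq_true, List.mem_range] at h
  refine isGridNet_net.subset_frontier strictMono_gapsX strictMono_gapsY
    (h f.code f.code_lt i i.2) ?_
  simp only [spanBox, min_self, max_self]
  rw [Box.toSet_point]
  rfl

/-- The creases of the net: the sides of panels that are not on the perimeter. -/
def netCreases : Set (E2 × E2) :=
  {c | ∃ (f : Face) (i : Fin 4), onPerimeter f.code i = false ∧
    c = (panelPos f i, panelPos f (finRotate 4 i))}

lemma panelMap_injective (f : Face) : Function.Injective (panelMap f) := (panelMap f).injective

/-- The dichotomy between crease and cut for one side of `f`, in terms of points. -/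
lemma shared_or_subset_frontier {f g : Face} (h : f ≠ g) {i : Fin 4}
    (h1 : ∃ j, faceCorner g j = faceCorner f i)
    (h2 : ∃ j, faceCorner g j = faceCorner f (finRotate 4 i)) :
    (∀ x ∈ segment ℝ (panelPos f i) (panelPos f (finRotate 4 i)),
      x ∈ panel g ∧ panelMap f x = panelMap g x) ∨
    segment ℝ (panelPos f i) (panelPos f (finRotate 4 i)) ⊆ frontier netRegion := by
  have hk := shared_or_onPerimeter
  simp only [List.all_eq_true, List.mem_range, Bool.or_eq_true, Bool.and_eq_true,
    Bool.not_eq_true', Nat.beq_eq] at hk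
  rw [← isCommon_iff] at h1 h2
  have h2 : isCommon f.code g.code (i + 1) = true := by
    rw [fin4_finRotate_val] at h2
    simpa only [isCommon, cornerCode_mod] using h2
  rcases hk f.code f.code_lt g.code g.code_lt i i.2 with (((hk | hk) | hk) | ⟨k1, k2⟩) | hk
  · exact absurd hk (Face.code_injective.ne h)
  · rw [h1] at hk; exact Bool.noConfusion hk
  · rw [h2] at hk; exact Bool.noConfusion hk
  · left
    have e1 := panelMap_eq_of_isShared k1
    have e2 := panelMap_eq_of_isShared (f := f) (g := g) (i := finRotate 4 i)
      (by rw [fin4_finRotate_val, isShared_mod]; exact k2)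
    exact fun x hx => ⟨(Box.convex _).segment_subset e1.1 e2.1 hx, eq_on_segment e1.2 e2.2 hx⟩
  · exact Or.inr (side_subset_frontier hk)

lemma mem_segment_of_panelMap {f : Face} {i j : Fin 4} {x : E2}
    (h : panelMap f x ∈ segment ℝ (facePos f i) (facePos f j)) :
    x ∈ segment ℝ (panelPos f i) (panelPos f j) := by
  rw [← panelMap_panelPos, ← panelMap_panelPos] at h
  have := image_segment ℝ (panelMap f).toAffineMap (panelPos f i) (panelPos f j)
  simp only [AffineIsometry.coe_toAffineMap] at this
  rw [← this] at h
  obtain ⟨y, hy, hyx⟩ := h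
  rwa [← panelMap_injective f hyx]

/-- The common image lies in the intersection of two faces. A shared vertex comes from corners, all
on the perimeter. On a shared edge, a crease makes the two maps agree and injectivity gives `x = y`;
for a cut, both points are on the perimeter. -/
lemma netMap_glue {f g : Face} {x y : E2} (hx : x ∈ panel f) (hy : y ∈ panel g)
    (h : panelMap f x = panelMap g y) :
    x = y ∨ (x ∈ frontier netRegion ∧ y ∈ frontier netRegion) := by
  by_cases hfg : f = g
  · subst hfg
    exact Or.inl (panelMap_injective f h)
  have hm : panelMap f x ∈ faceRegion f ∩ faceRegion g := by
    refine ⟨panelMap_image f ▸ ⟨x, hx, rfl⟩, ?_⟩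
    rw [h]
    exact panelMap_image g ▸ ⟨y, hy, rfl⟩
  rcases faceRegion_inter hfg with hd | ⟨i, j, hij, hd⟩ | ⟨i, j, hij, hd⟩
  · exact absurd hm (Set.disjoint_iff.1 hd ·)
  · rw [hd] at hm
    right
    constructor
    · rw [panelMap_injective f (Eq.trans hm (panelMap_panelPos f i).symm)]
      exact panelPos_mem_frontier f i
    · have : panelMap g y = panelMap g (panelPos g j) := by
        rw [← h, panelMap_panelPos, Set.mem_singleton_iff.1 hm, facePos, facePos, hij]
      rw [panelMap_injective g this]
      exact panelPos_mem_frontier g j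
  · rw [hd] at hm
    have hxs := mem_segment_of_panelMap hm
    have hys : y ∈ segment ℝ (panelPos g j) (panelPos g (finRotate 4 j)) := by
      refine mem_segment_of_panelMap ?_
      rw [← h]
      rcases hij with ⟨h1, h2⟩ | ⟨h1, h2⟩
      · rw [facePos, facePos, ← h1, ← h2]; exact hm
      · rw [facePos, facePos, ← h1, ← h2, segment_symm]; exact hm
    have hc : (∃ l, faceCorner g l = faceCorner f i) ∧
        (∃ l, faceCorner g l = faceCorner f (finRotate 4 i)) ∧
        (∃ l, faceCorner f l = faceCorner g j) ∧
        ∃ l, faceCorner f l = faceCorner g (finRotate 4 j) := by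
      rcases hij with ⟨h1, h2⟩ | ⟨h1, h2⟩
      · exact ⟨⟨_, h1.symm⟩, ⟨_, h2.symm⟩, ⟨_, h1⟩, ⟨_, h2⟩⟩
      · exact ⟨⟨_, h1.symm⟩, ⟨_, h2.symm⟩, ⟨_, h2⟩, ⟨_, h1⟩⟩
    rcases shared_or_subset_frontier hfg hc.1 hc.2.1 with k | k
    · left
      have := (k x hxs).2
      exact panelMap_injective g (this.symm.trans h)
    -- The first alternative only places `x` on the perimeter; the exchanged roles of `f` and `g`
    -- treat `y`.
    rcases shared_or_subset_frontier (Ne.symm hfg) hc.2.2.1 hc.2.2.2 with k' | k'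
    · left
      have := (k' y hys).2
      exact panelMap_injective f (h.trans this)
    · exact Or.inr ⟨k hxs, k' hys⟩

lemma panel_side_parallel (f : Face) (i : Fin 4) : ∃ (l : Fin 98) (t : ℝ),
    panelPos f (finRotate 4 i) - panelPos f i =
      t • (netPolygon (finRotate 98 l) - netPolygon l) := by
  have hc := (isCornerCycle_panel f.code f.code_lt).2
  simp only [Fin.val_zero, Fin.val_one, Fin.val_two, val_three] at hc
  have hs : (panelCorner f.code i).1 = (panelCorner f.code (finRotate 4 i)).1 ∨
      (panelCorner f.code i).2 = (panelCorner f.code (finRotate 4 i)).2 := by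
    rw [fin4_finRotate_val]
    rcases hc with ⟨h1, h3⟩ | ⟨h1, h3⟩ <;> fin_cases i <;> simp [h1, h3]
  -- Side 0 of the net is vertical and side 1 is horizontal; every panel side is a multiple of one
  -- of them.
  have n0 : netCorner 0 = (1, 8) := rfl
  have n1 : netCorner 1 = (1, 11) := rfl
  have n2 : netCorner 2 = (2, 11) := rfl
  rcases hs with hs | hs
  · refine ⟨0, (gridLine gapsY (panelCorner f.code (finRotate 4 i)).2 -
      gridLine gapsY (panelCorner f.code i).2) / (gridLine gapsY 11 - gridLine gapsY 8), ?_⟩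
    have hne : gridLine gapsY 11 - gridLine gapsY 8 ≠ 0 :=
      (sub_pos.2 (strictMono_gapsY (by norm_num))).ne'
    refine E2_ext ?_ ?_
    · simp [panelPos, gridPt, hs, netPolygon, gridPolygon, n0, n1]
    · simp [panelPos, gridPt, netPolygon, gridPolygon, n0, n1, hne]
  · refine ⟨1, (gridLine gapsX (panelCorner f.code (finRotate 4 i)).1 -
      gridLine gapsX (panelCorner f.code i).1) / (gridLine gapsX 2 - gridLine gapsX 1), ?_⟩
    have hne : gridLine gapsX 2 - gridLine gapsX 1 ≠ 0 :=
      (sub_pos.2 (strictMono_gapsX (by norm_num))).ne'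
    refine E2_ext ?_ ?_
    · simp [panelPos, gridPt, netPolygon, gridPolygon, n1, n2, hne]
    · simp [panelPos, gridPt, hs, netPolygon, gridPolygon, n1, n2]

theorem isOrthogonalFolding :
    IsOrthogonalFolding netPolygon netRegion (cubedOctopus 3).carrier netCreases netMap where
  finite_creases := by
    have : Finite Face := Finite.of_equiv _ faceEquiv.symm
    refine (Set.finite_range fun p : Face × Fin 4 =>
      (panelPos p.1 p.2, panelPos p.1 (finRotate 4 p.2))).subset ?_
    rintro _ ⟨f, i, -, rfl⟩
    exact ⟨(f, i), rfl⟩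
  crease_ne := by
    rintro _ ⟨f, i, -, rfl⟩ h
    have h' := congrArg (panelMap f) h
    simp only [panelMap_panelPos] at h'
    have h' := congrArg Vertex.code (vertexPos_injective h')
    rw [code_faceCorner, code_faceCorner] at h'
    have := cornerCode_inj f.code_lt i.2 (finRotate 4 i).2 h'
    rw [fin4_finRotate_val] at this
    omega
  crease_subset := by
    rintro _ ⟨f, i, -, rfl⟩ x hx
    exact mem_netRegion.2 ⟨f,
      (Box.convex _).segment_subset (panelPos_mem f _) (panelPos_mem f _) hx⟩
  crease_parallel := by
    rintro _ ⟨f, i, -, rfl⟩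
    exact panel_side_parallel f i
  continuousOn := by
    have : Finite Face := Finite.of_equiv _ faceEquiv.symm
    have hN : netRegion = ⋃ f, panel f := by
      ext x; rw [mem_netRegion, Set.mem_iUnion]
    rw [hN]
    -- Pasting over a finite cover by closed panels.
    refine LocallyFinite.continuousOn_iUnion (locallyFinite_of_finite _) (fun f => Box.isClosed _)
      fun f => ?_
    exact (panelMap f).continuous.continuousOn.congr fun x hx => netMap_eq hx
  rigid := by
    intro x hx hC
    obtain ⟨f, hf⟩ := mem_netRegion.1 (interior_subset hx)
    refine ⟨panelMap f, ?_⟩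
    -- A point with no panel as a neighbourhood is on a panel side, which is either on the perimeter
    -- or a crease; both are excluded.
    rcases (isCornerCycle_panel f.code f.code_lt).mem_nhds_or hf with h | ⟨i, h⟩
    · filter_upwards [h] with y hy
      exact netMap_eq hy
    · have h : x ∈ segment ℝ (panelPos f i) (panelPos f (finRotate 4 i)) := by
        rw [spanBox_panelCorner, panelSide, ← panelCorner_mod f.code (i + 1), ← fin4_finRotate_val]
        exact h
      cases hp : onPerimeter f.code i with
      | true => exact absurd hx (side_subset_frontier hp h).2
      | false => exact absurd h (hC _ ⟨f, i, hp, rfl⟩)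
  image_eq := by
    rw [carrier_eq]
    ext p
    rw [Set.mem_iUnion]
    constructor
    · rintro ⟨x, hx, rfl⟩
      obtain ⟨f, hf⟩ := mem_netRegion.1 hx
      rw [netMap_eq hf]
      exact ⟨f, panelMap_image f ▸ ⟨x, hf, rfl⟩⟩
    · rintro ⟨f, hp⟩
      rw [← panelMap_image] at hp
      obtain ⟨x, hx, rfl⟩ := hp
      exact ⟨x, mem_netRegion.2 ⟨f, hx⟩, netMap_eq hx⟩
  glue := by
    intro x hx y hy h
    obtain ⟨f, hf⟩ := mem_netRegion.1 hx
    obtain ⟨g, hg⟩ := mem_netRegion.1 hy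
    rw [netMap_eq hf, netMap_eq hg] at h
    exact netMap_glue hf hg h

end NonorthFold

theorem mainTheorem3 :
    (NonorthFold.cubedOctopus 3).IsPolyhedron ∧
    (NonorthFold.cubedOctopus 3).HasGenus 7 ∧
    ¬ (NonorthFold.cubedOctopus 3).IsOrthogonal ∧
    ∃ (n : ℕ) (p : Polygon NonorthFold.E2 n) (N : Set NonorthFold.E2),
      NonorthFold.IsOrthogonalNet p N ∧
      NonorthFold.FoldsOrthogonally p N (NonorthFold.cubedOctopus 3).carrier :=
  ⟨NonorthFold.isPolyhedron, NonorthFold.hasGenus, NonorthFold.not_isOrthogonal, 98,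
    NonorthFold.netPolygon, NonorthFold.netRegion, NonorthFold.isOrthogonalNet,
    NonorthFold.netCreases, NonorthFold.netMap, NonorthFold.isOrthogonalFolding⟩
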